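/- Let $\omega\in\mathbb R$ with $|\omega|<\tfrac23$. For complex-valued $u,v\in H^1(\mathbb R)$ put $$J[u,v]=\int_{\mathbb R}3\big(|u|^4+|v|^4+4|u|^2|v|^2\big)+4\,\Re(\bar u^3v)\,dx,\qquad I[u,v]=\int_{\mathbb R}|u'|^2+|v'|^2+(4-\omega^2)|u|^2+(4-9\omega^2)|v|^2\,dx,$$ and $J_0=\sup\{J[u,v]: I[u,v]=1\}$. Let $(U,V)$ be a maximizer of $J$ under the constraint $I=1$ such that $U,V\in H^1(\mathbb R)$ are real-valued and bell-shaped (nonnegative, even, and nonincreasing on $(0,\infty)$), and let $(\phi,\psi)=(2J_0)^{-1/2}(U,V)$ be the corresponding steady state of the system $$-\phi''+(4-\omega^2)\phi-(6\phi^3+6\phi^2\psi+12\phi\psi^2)=0,\qquad -\psi''+(4-9\omega^2)\psi-(2\phi^3+12\phi^2\psi+6\psi^3)=0.$$ Consider in $L^2(\mathbb R)^4$ the linearized operator $$\mathcal H=\begin{pmatrix}\mathcal H_1&0&-24\phi\psi-6\phi^2&0\\0&\mathcal H_2&0&-6\phi^2\\-24\phi\psi-6\phi^2&0&\mathcal H_3&0\\0&-6\phi^2&0&\mathcal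 H_4\end{pmatrix},$$ $$\mathcal H_1=-\partial_{xx}+(4-\omega^2)-18\phi^2-12\psi^2-12\phi\psi,\qquad \mathcal H_2=-\partial_{xx}+(4-\omega^2)-6\phi^2-12\psi^2+12\phi\psi,$$ $$\mathcal H_3=-\partial_{xx}+(4-9\omega^2)-12\phi^2-18\psi^2,\qquad \mathcal H_4=-\partial_{xx}+(4-9\omega^2)-12\phi^2-6\psi^2 .$$ Then $\mathcal H$ is self-adjoint with domain $H^2(\mathbb R)^4$, and it has exactly one negative eigenvalue, which is simple. Moreover its Morse index $n(\mathcal H)$, the largest dimension of a subspace of the domain on which the form $\langle\mathcal H z,z\rangle$ is negative definite, equals $1$. -/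

import Mathlib

open MeasureTheory TemperedDistribution
open scoped LineDeriv SchwartzMap ENNReal ComplexConjugate

noncomputable section

namespace Oscillon

/-- The complex Hilbert space `L²(ℝ)`. -/
abbrev L2 : Type := Lp ℂ 2 (volume : Measure ℝ)

/-- The Sobolev space `H¹(ℝ)` as a subspace of `L²(ℝ)`. -/
def H1 : Submodule ℂ L2 where
  carrier := {f | MemSobolev 1 2 (f : 𝓢'(ℝ, ℂ))}
  add_mem' {f g} hf hg := by
    have h : ((f + g : L2) : 𝓢'(ℝ, ℂ)) = (f : 𝓢'(ℝ, ℂ)) + (g : 𝓢'(ℝ, ℂ)) :=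
      map_add (Lp.toTemperedDistributionCLM ℂ (volume : Measure ℝ) 2) f g
    simpa only [Set.mem_ofPred_eq, h] using MemSobolev.add hf hg
  zero_mem' := by
    have h : ((0 : L2) : 𝓢'(ℝ, ℂ)) = 0 :=
      map_zero (Lp.toTemperedDistributionCLM ℂ (volume : Measure ℝ) 2)
    simpa only [Set.mem_ofPred_eq, h] using memSobolev_fun_zero (E := ℝ) (F := ℂ) (p := 2) 1
  smul_mem' c f hf := by
    have h : ((c • f : L2) : 𝓢'(ℝ, ℂ)) = c • (f : 𝓢'(ℝ, ℂ)) :=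
      map_smul (Lp.toTemperedDistributionCLM ℂ (volume : Measure ℝ) 2) c f
    simpa only [Set.mem_ofPred_eq, h] using MemSobolev.smul c hf

/-- The Sobolev space `H²(ℝ)` as a subspace of `L²(ℝ)`. -/
def H2 : Submodule ℂ L2 where
  carrier := {f | MemSobolev 2 2 (f : 𝓢'(ℝ, ℂ))}
  add_mem' {f g} hf hg := by
    have h : ((f + g : L2) : 𝓢'(ℝ, ℂ)) = (f : 𝓢'(ℝ, ℂ)) + (g : 𝓢'(ℝ, ℂ)) :=
      map_add (Lp.toTemperedDistributionCLM ℂ (volume : Measure ℝ) 2) f g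
    simpa only [Set.mem_ofPred_eq, h] using MemSobolev.add hf hg
  zero_mem' := by
    have h : ((0 : L2) : 𝓢'(ℝ, ℂ)) = 0 :=
      map_zero (Lp.toTemperedDistributionCLM ℂ (volume : Measure ℝ) 2)
    simpa only [Set.mem_ofPred_eq, h] using memSobolev_fun_zero (E := ℝ) (F := ℂ) (p := 2) 2
  smul_mem' c f hf := by
    have h : ((c • f : L2) : 𝓢'(ℝ, ℂ)) = c • (f : 𝓢'(ℝ, ℂ)) :=
      map_smul (Lp.toTemperedDistributionCLM ℂ (volume : Measure ℝ) 2) c f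
    simpa only [Set.mem_ofPred_eq, h] using MemSobolev.smul c hf

open Classical in
/-- The weak (distributional) derivative of `f ∈ L²(ℝ)` when it lies in `L²(ℝ)`, and `0`
otherwise. -/
def weakDeriv (f : L2) : L2 :=
  if h : ∃ g : L2, ∂_{(1 : ℝ)} (f : 𝓢'(ℝ, ℂ)) = (g : 𝓢'(ℝ, ℂ)) then h.choose else 0

theorem coe_injective {f g : L2} (h : (f : 𝓢'(ℝ, ℂ)) = (g : 𝓢'(ℝ, ℂ))) : f = g :=
  LinearMap.ker_eq_bot.mp
    (Lp.ker_toTemperedDistributionCLM_eq_bot (F := ℂ) (μ := (volume : Measure ℝ)) (p := 2)) h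

theorem weakDeriv_eq {f g : L2} (h : ∂_{(1 : ℝ)} (f : 𝓢'(ℝ, ℂ)) = (g : 𝓢'(ℝ, ℂ))) :
    weakDeriv f = g := by
  have h' : ∃ g : L2, ∂_{(1 : ℝ)} (f : 𝓢'(ℝ, ℂ)) = (g : 𝓢'(ℝ, ℂ)) := ⟨g, h⟩
  rw [weakDeriv, dif_pos h']
  exact coe_injective (h'.choose_spec.symm.trans h)

theorem coe_weakDeriv {f : L2} (hf : f ∈ H1) :
    ∂_{(1 : ℝ)} (f : 𝓢'(ℝ, ℂ)) = (weakDeriv f : 𝓢'(ℝ, ℂ)) := by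
  have h := MemSobolev.lineDerivOp (m := (1 : ℝ)) (show MemSobolev 1 2 (f : 𝓢'(ℝ, ℂ)) from hf)
  rw [sub_self, memSobolev_zero_iff] at h
  obtain ⟨g, hg⟩ := h
  rw [weakDeriv_eq hg, hg]

theorem weakDeriv_add {f g : L2} (hf : f ∈ H1) (hg : g ∈ H1) :
    weakDeriv (f + g) = weakDeriv f + weakDeriv g := by
  apply weakDeriv_eq
  have h (a b : L2) : ((a + b : L2) : 𝓢'(ℝ, ℂ)) = (a : 𝓢'(ℝ, ℂ)) + (b : 𝓢'(ℝ, ℂ)) :=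
    map_add (Lp.toTemperedDistributionCLM ℂ (volume : Measure ℝ) 2) a b
  rw [h, h, LineDeriv.lineDerivOp_add, coe_weakDeriv hf, coe_weakDeriv hg]

theorem weakDeriv_smul (c : ℂ) {f : L2} (hf : f ∈ H1) :
    weakDeriv (c • f) = c • weakDeriv f := by
  apply weakDeriv_eq
  have h (a : L2) : ((c • a : L2) : 𝓢'(ℝ, ℂ)) = c • (a : 𝓢'(ℝ, ℂ)) :=
    map_smul (Lp.toTemperedDistributionCLM ℂ (volume : Measure ℝ) 2) c a
  rw [h, h, LineDeriv.lineDerivOp_smul, coe_weakDeriv hf]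

theorem H2_le_H1 : H2 ≤ H1 := fun _ hf => MemSobolev.mono (by norm_num) hf

theorem weakDeriv_mem_H1 {f : L2} (hf : f ∈ H2) : weakDeriv f ∈ H1 := by
  have h := MemSobolev.lineDerivOp (m := (1 : ℝ)) (show MemSobolev 2 2 (f : 𝓢'(ℝ, ℂ)) from hf)
  rw [coe_weakDeriv (H2_le_H1 hf)] at h
  norm_num at h
  exact h

/-! ### The variational problem -/

/-- `I[u, v] = ∫ |u'|² + |v'|² + (4 - ω²)|u|² + (4 - 9ω²)|v|²`. -/
def energyI (ω : ℝ) (u v : L2) : ℝ :=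
  ∫ x, ‖weakDeriv u x‖ ^ 2 + ‖weakDeriv v x‖ ^ 2
    + (4 - ω ^ 2) * ‖u x‖ ^ 2 + (4 - 9 * ω ^ 2) * ‖v x‖ ^ 2

/-- `J[u, v] = ∫ 3(|u|⁴ + |v|⁴ + 4|u|²|v|²) + 4 Re(ū³ v)`. -/
def energyJ (u v : L2) : ℝ :=
  ∫ x, 3 * (‖u x‖ ^ 4 + ‖v x‖ ^ 4 + 4 * ‖u x‖ ^ 2 * ‖v x‖ ^ 2)
    + 4 * (conj (u x) ^ 3 * v x).re

/-- `(U, V)` solves the problem `J[u, v] → max` over complex-valued `u, v ∈ H¹(ℝ)` with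
`I[u, v] = 1`. -/
def IsMaximizer (ω : ℝ) (U V : L2) : Prop :=
  U ∈ H1 ∧ V ∈ H1 ∧ energyI ω U V = 1 ∧
    ∀ u ∈ H1, ∀ v ∈ H1, energyI ω u v = 1 → energyJ u v ≤ energyJ U V

/-- `J₀ = sup {J[u, v] : I[u, v] = 1}`. -/
def J0 (ω : ℝ) : ℝ :=
  sSup {c | ∃ u ∈ H1, ∃ v ∈ H1, energyI ω u v = 1 ∧ c = energyJ u v}

/-- Nonnegative, even, and nonincreasing on `(0, ∞)`. -/
structure BellShaped (f : ℝ → ℝ) : Prop where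
  nonneg : ∀ x, 0 ≤ f x
  even : ∀ x, f (-x) = f x
  antitone : AntitoneOn f (Set.Ioi 0)

/-- `(φ, ψ) = (2 J₀)^{-1/2} (U, V)` for a bell-shaped maximizer `(U, V)`. -/
def IsOscillonWave (ω : ℝ) (φ ψ : ℝ → ℝ) : Prop :=
  ∃ U V : ℝ → ℝ, BellShaped U ∧ BellShaped V ∧
    (∃ (hU : MemLp (fun x => (U x : ℂ)) 2 volume) (hV : MemLp (fun x => (V x : ℂ)) 2 volume),
      IsMaximizer ω (hU.toLp _) (hV.toLp _)) ∧
    (∀ x, φ x = U x / √(2 * J0 ω)) ∧ (∀ x, ψ x = V x / √(2 * J0 ω))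

/-! ### The linearized operator -/

/-- The Hilbert space `L²(ℝ)⁴`. -/
abbrev L24 : Type := PiLp 2 (fun _ : Fin 4 => L2)

/-- The constant part `diag(4 - ω², 4 - ω², 4 - 9ω², 4 - 9ω²)`. -/
def massCoeff (ω : ℝ) : Fin 4 → ℝ :=
  ![4 - ω ^ 2, 4 - ω ^ 2, 4 - 9 * ω ^ 2, 4 - 9 * ω ^ 2]

/-- The matrix potential of the linearization, at a point where the waves have the values
`a = φ(x)` and `b = ψ(x)`. -/
def potential (a b : ℝ) : Matrix (Fin 4) (Fin 4) ℝ :=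
  !![-18 * a ^ 2 - 12 * b ^ 2 - 12 * a * b, 0, -24 * a * b - 6 * a ^ 2, 0;
     0, -6 * a ^ 2 - 12 * b ^ 2 + 12 * a * b, 0, -6 * a ^ 2;
     -24 * a * b - 6 * a ^ 2, 0, -12 * a ^ 2 - 18 * b ^ 2, 0;
     0, -6 * a ^ 2, 0, -12 * a ^ 2 - 6 * b ^ 2]

/-- The `i`-th component of the potential matrix applied to `z`. -/
def potentialMul (φ ψ : ℝ → ℝ) (z : L24) (i : Fin 4) (x : ℝ) : ℂ :=
  ∑ j, (potential (φ x) (ψ x) i j : ℂ) * z j x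

theorem potentialMul_add (φ ψ : ℝ → ℝ) (z w : L24) (i : Fin 4) :
    potentialMul φ ψ (z + w) i =ᵐ[volume] potentialMul φ ψ z i + potentialMul φ ψ w i := by
  have h : ∀ᵐ x : ℝ, ∀ j, (z + w) j x = z j x + w j x :=
    ae_all_iff.2 fun j => Lp.coeFn_add (z j) (w j)
  filter_upwards [h] with x hx
  simp only [potentialMul, Pi.add_apply, hx, mul_add, Finset.sum_add_distrib]

theorem potentialMul_smul (φ ψ : ℝ → ℝ) (c : ℂ) (z : L24) (i : Fin 4) :
    potentialMul φ ψ (c • z) i =ᵐ[volume] c • potentialMul φ ψ z i := by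
  have h : ∀ᵐ x : ℝ, ∀ j, (c • z) j x = c * z j x :=
    ae_all_iff.2 fun j => Lp.coeFn_smul c (z j)
  filter_upwards [h] with x hx
  simp only [potentialMul, Pi.smul_apply, hx, smul_eq_mul, Finset.mul_sum]
  exact Finset.sum_congr rfl fun j _ => by ring

theorem potentialMul_zero (φ ψ : ℝ → ℝ) (i : Fin 4) :
    potentialMul φ ψ 0 i =ᵐ[volume] 0 := by
  simpa using potentialMul_smul φ ψ 0 0 i

/-- The vectors with components in `H²(ℝ)` that the potential maps into `L²(ℝ)⁴`; this is all of
`H²(ℝ)⁴` when `φ, ψ` are bounded and measurable. -/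
def linDomain (φ ψ : ℝ → ℝ) : Submodule ℂ L24 where
  carrier := {z | (∀ i, z i ∈ H2) ∧ ∀ i, MemLp (potentialMul φ ψ z i) 2 volume}
  add_mem' {z w} hz hw :=
    ⟨fun i => H2.add_mem (hz.1 i) (hw.1 i), fun i =>
      (memLp_congr_ae (potentialMul_add φ ψ z w i)).2 ((hz.2 i).add (hw.2 i))⟩
  zero_mem' := ⟨fun _ => H2.zero_mem, fun i =>
      (memLp_congr_ae (potentialMul_zero φ ψ i)).2 MemLp.zero⟩
  smul_mem' c z hz :=
    ⟨fun i => H2.smul_mem c (hz.1 i), fun i =>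
      (memLp_congr_ae (potentialMul_smul φ ψ c z i)).2 ((hz.2 i).const_smul c)⟩

/-- The unbounded operator `𝓗 = -∂ₓₓ + massCoeff + potential(φ, ψ)` in `L²(ℝ)⁴`. -/
def linOp (ω : ℝ) (φ ψ : ℝ → ℝ) : L24 →ₗ.[ℂ] L24 where
  domain := linDomain φ ψ
  toFun :=
    { toFun := fun z => WithLp.toLp 2 fun i =>
        -weakDeriv (weakDeriv (z.1 i)) + (massCoeff ω i : ℂ) • z.1 i + (z.2.2 i).toLp _
      map_add' := fun z w => by
        ext1 i
        have h2 : ((z + w).2.2 i).toLp _ = (z.2.2 i).toLp _ + (w.2.2 i).toLp _ := by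
          rw [← MemLp.toLp_add]
          exact MemLp.toLp_congr _ _ (potentialMul_add φ ψ z.1 w.1 i)
        have h1 : weakDeriv (weakDeriv ((z + w).1 i)) =
            weakDeriv (weakDeriv (z.1 i)) + weakDeriv (weakDeriv (w.1 i)) := by
          rw [← weakDeriv_add (weakDeriv_mem_H1 (z.2.1 i)) (weakDeriv_mem_H1 (w.2.1 i)),
            ← weakDeriv_add (H2_le_H1 (z.2.1 i)) (H2_le_H1 (w.2.1 i))]
          rfl
        have h3 : (z + w).1 i = z.1 i + w.1 i := rfl
        simp only [PiLp.add_apply]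
        rw [h2, h1, h3, smul_add]
        abel
      map_smul' := fun c z => by
        ext1 i
        have h2 : ((c • z).2.2 i).toLp _ = c • (z.2.2 i).toLp _ := by
          rw [← MemLp.toLp_const_smul]
          exact MemLp.toLp_congr _ _ (potentialMul_smul φ ψ c z.1 i)
        have h1 : weakDeriv (weakDeriv ((c • z).1 i)) =
            c • weakDeriv (weakDeriv (z.1 i)) := by
          rw [← weakDeriv_smul c (weakDeriv_mem_H1 (z.2.1 i)),
            ← weakDeriv_smul c (H2_le_H1 (z.2.1 i))]
          rfl
        have h3 : (c • z).1 i = c • z.1 i := rfl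
        simp only [PiLp.smul_apply, RingHom.id_apply]
        rw [h2, h1, h3, smul_add, smul_add, smul_neg, smul_comm c] }

/-! ### Negative eigenvalues and the Morse index -/

/-- The eigenspace `{z ∈ D(A) : A z = σ z}` of an unbounded operator. -/
def eigenspace {E : Type*} [AddCommGroup E] [Module ℂ E] (A : E →ₗ.[ℂ] E) (σ : ℂ) :
    Submodule ℂ E :=
  (LinearMap.ker (A.toFun - σ • A.domain.subtype)).map A.domain.subtype

/-- The Morse index `n(A)` of a self-adjoint operator: the dimension of its negative subspace,
i.e. the largest dimension of a subspace of `D(A)` on which the form `⟨A z, z⟩` is negative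
definite. -/
def morseIndex {E : Type*} [NormedAddCommGroup E] [InnerProductSpace ℂ E] (A : E →ₗ.[ℂ] E) :
    ℕ∞ :=
  ⨆ (W : Submodule ℂ E) (_ : W ≤ A.domain)
    (_ : ∀ z : A.domain, (z : E) ∈ W → z ≠ 0 → (inner ℂ (A z) (z : E)).re < 0),
    (Module.rank ℂ W).toENat

end Oscillon

end

noncomputable section

namespace Oscillon

/-! ### Self-adjoint operators with a one-dimensional negative direction -/

section Abstract

variable {E : Type*} [NormedAddCommGroup E] [InnerProductSpace ℂ E]

/-! The functionals `I` and `J` are homogeneous of degrees 2 and 4, so maximality of `(U, V)` is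
equivalent to the unconstrained inequality `J ≤ J₀ I²`, with equality at `(U, V)` (`energyJ_le`).
Along a line `(U + t h, V + t k)` both sides are quartic polynomials in `t`. Their difference is
nonnegative and vanishes at `t = 0`, so its linear coefficient is zero (Euler–Lagrange) and its
quadratic coefficient is nonnegative (`first_and_second_variation`). For complex `h, k` the second
variation is a real quadratic form in `(Re h, Im h, Re k, Im k)`. After rescaling by `(2 J₀)^{-1/2}`
this form, on directions annihilated by the first variation of `I`, is exactly the form of `𝓗`.

Hence `𝓗` is nonnegative on the kernel of one linear functional (`linOp_nonneg_of_formI_eq_zero`),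
while at `(φ, 0, ψ, 0)` its form equals `-2 (2 J₀)⁻¹ < 0` (`exists_linOp_neg`). The complex space
`L²(ℝ)⁴` is handled by splitting a vector into real and imaginary parts, since `𝓗` has real
coefficients.

What remains is abstract: a self-adjoint operator that is bounded below, nonnegative on a hyperplane
and negative somewhere has one simple negative eigenvalue and Morse index 1. Existence of the
eigenvalue (`exists_neg_eigenvector`) is reduced to bounded operators by means of a resolvent;
uniqueness and simplicity are dimension counts against the functional.

On the analytic side, `H¹ ⊂ L^∞` makes the potential bounded, a distributional second derivative in
`L²` puts a function in `H²` (this gives self-adjointness), and the Euler–Lagrange equation puts the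
maximizer in `H²`, so that the negative direction lies in the domain. -/

theorem mem_eigenspace_iff {A : E →ₗ.[ℂ] E} {σ : ℂ} {z : E} :
    z ∈ eigenspace A σ ↔ ∃ h : z ∈ A.domain, A ⟨z, h⟩ = σ • z := by
  simp only [eigenspace, Submodule.mem_map, LinearMap.mem_ker, LinearMap.sub_apply,
    LinearMap.smul_apply, Submodule.subtype_apply, sub_eq_zero]
  constructor
  · rintro ⟨y, hy, rfl⟩
    exact ⟨y.2, hy⟩
  · rintro ⟨h, hz⟩
    exact ⟨⟨z, h⟩, hz, rfl⟩

/-- A subspace of the domain on which a linear functional has trivial kernel is at most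
one-dimensional. -/
theorem rank_le_one_of_functional {D : Submodule ℂ E} (l : D →ₗ[ℂ] ℂ) {W : Submodule ℂ E}
    (hW : W ≤ D) (h : ∀ z : D, (z : E) ∈ W → l z = 0 → z = 0) : Module.rank ℂ W ≤ 1 := by
  have hinj : Function.Injective (l ∘ₗ Submodule.inclusion hW) := by
    rw [injective_iff_map_eq_zero]
    intro w hw
    have := h (Submodule.inclusion hW w) w.2 hw
    exact Subtype.ext (congrArg (fun z : D => (z : E)) this)
  simpa using LinearMap.lift_rank_le_of_injective _ hinj

variable {A : E →ₗ.[ℂ] E}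

theorem symmetric_of_isSelfAdjoint [CompleteSpace E] (hA : IsSelfAdjoint A) (x y : A.domain) :
    inner ℂ (A x) (y : E) = inner ℂ (x : E) (A y) := by
  have h := LinearPMap.adjoint_isFormalAdjoint hA.dense_domain
  rw [LinearPMap.isSelfAdjoint_def.1 hA] at h
  exact h x y

/-- The shift `c + 1` makes the form of `A + (c + 1)` at least `‖z‖²`; Cauchy–Schwarz then gives the
bound. -/
theorem norm_le_norm_add_smul {c : ℝ}
    (hc : ∀ z : A.domain, -c * ‖(z : E)‖ ^ 2 ≤ (inner ℂ (A z) (z : E)).re) (z : A.domain) :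
    ‖(z : E)‖ ≤ ‖A z + ((c + 1 : ℝ) : ℂ) • (z : E)‖ := by
  have h1 : ‖(z : E)‖ ^ 2 ≤ (inner ℂ (A z + ((c + 1 : ℝ) : ℂ) • (z : E)) (z : E)).re := by
    rw [inner_add_left, inner_smul_left, Complex.conj_ofReal, Complex.add_re,
      Complex.re_ofReal_mul]
    have : (inner ℂ (z : E) (z : E)).re = ‖(z : E)‖ ^ 2 := by
      simpa using inner_self_eq_norm_sq (𝕜 := ℂ) (z : E)
    rw [this]
    linarith [hc z]
  have h2 := h1.trans ((Complex.re_le_norm _).trans (norm_inner_le_norm _ _))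
  rcases (norm_nonneg (z : E)).eq_or_lt with h0 | h0
  · rw [← h0]; exact norm_nonneg _
  · nlinarith

theorem re_inner_self_pos {x : E} (hx : x ≠ 0) : 0 < (inner ℂ x x).re := by
  have : (inner ℂ x x).re = ‖x‖ ^ 2 := by simpa using inner_self_eq_norm_sq (𝕜 := ℂ) x
  rw [this]
  positivity

/-- A negative definite subspace meets the kernel of `l` trivially, so `l` embeds it in `ℂ`; the
line through `z₀` attains dimension one. -/
theorem morseIndex_eq_one (l : A.domain →ₗ[ℂ] ℂ)
    (hl : ∀ z, l z = 0 → 0 ≤ (inner ℂ (A z) (z : E)).re)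
    {z₀ : A.domain} (hz₀ : (inner ℂ (A z₀) (z₀ : E)).re < 0) : morseIndex A = 1 := by
  refine le_antisymm ?_ ?_
  · refine iSup_le fun W => iSup_le fun hW => iSup_le fun hneg => ?_
    have h1 : Module.rank ℂ W ≤ 1 := by
      refine rank_le_one_of_functional l hW fun z hz hlz => ?_
      by_contra hne
      exact absurd (hneg z hz hne) (not_lt.2 (hl z hlz))
    simpa using OrderHomClass.mono Cardinal.toENat h1
  · have hne : (z₀ : E) ≠ 0 := by
      intro h
      rw [h, inner_zero_right] at hz₀
      simp at hz₀
    have hW : (ℂ ∙ (z₀ : E)) ≤ A.domain :=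
      (Submodule.span_singleton_le_iff_mem _ _).2 z₀.2
    have hneg : ∀ z : A.domain, (z : E) ∈ (ℂ ∙ (z₀ : E)) → z ≠ 0 →
        (inner ℂ (A z) (z : E)).re < 0 := by
      intro z hz hz0
      obtain ⟨a, ha⟩ := Submodule.mem_span_singleton.1 hz
      have hz' : z = a • z₀ := Subtype.ext ha.symm
      have ha0 : a ≠ 0 := by
        rintro rfl
        exact hz0 (by rw [hz', zero_smul])
      rw [hz', LinearPMap.map_smul, Submodule.coe_smul, inner_smul_left, inner_smul_right, ← mul_assoc,
        mul_comm (conj a), Complex.mul_conj, Complex.re_ofReal_mul]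
      exact mul_neg_of_pos_of_neg (Complex.normSq_pos.2 ha0) hz₀
    have h1 : (Module.rank ℂ (ℂ ∙ (z₀ : E))).toENat = 1 := by
      rw [Module.rank_eq_one_iff_finrank_eq_one.2 (finrank_span_singleton hne)]
      simp
    rw [← h1]
    exact le_iSup_of_le _ (le_iSup_of_le hW (le_iSup_of_le hneg le_rfl))

theorem inner_eigenvector_neg {σ : ℝ} (hσ : σ < 0) {z : A.domain} (hz : z ≠ 0)
    (h : A z = (σ : ℂ) • (z : E)) : (inner ℂ (A z) (z : E)).re < 0 := by
  rw [h, inner_smul_left, Complex.conj_ofReal, Complex.re_ofReal_mul]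
  exact mul_neg_of_neg_of_pos hσ (re_inner_self_pos fun h0 => hz (Subtype.ext h0))

theorem finrank_eigenspace_eq_one (l : A.domain →ₗ[ℂ] ℂ)
    (hl : ∀ z, l z = 0 → 0 ≤ (inner ℂ (A z) (z : E)).re) {σ : ℝ} (hσ : σ < 0) {e : A.domain}
    (he : e ≠ 0) (hAe : A e = (σ : ℂ) • (e : E)) :
    Module.finrank ℂ (eigenspace A (σ : ℂ)) = 1 := by
  have hrank : Module.rank ℂ (eigenspace A (σ : ℂ)) ≤ 1 := by
    refine rank_le_one_of_functional l
      (fun z hz => (mem_eigenspace_iff.1 hz).1) fun z hz hlz => ?_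
    obtain ⟨_, hz'⟩ := mem_eigenspace_iff.1 hz
    by_contra hne
    exact absurd (inner_eigenvector_neg hσ hne hz') (not_lt.2 (hl z hlz))
  have hpos : Module.rank ℂ (eigenspace A (σ : ℂ)) ≠ 0 := by
    rw [Ne, rank_zero_iff_forall_zero]
    intro h
    have := h ⟨(e : E), mem_eigenspace_iff.2 ⟨e.2, hAe⟩⟩
    exact he (Subtype.ext (congrArg (fun z : eigenspace A (σ : ℂ) => (z : E)) this))
  rw [← Module.rank_eq_one_iff_finrank_eq_one]
  exact le_antisymm hrank (Cardinal.one_le_iff_ne_zero.2 hpos)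

variable [CompleteSpace E]

/-- A self-adjoint operator shifted above its lower bound is onto. -/
theorem exists_add_smul_eq (hA : IsSelfAdjoint A) {c : ℝ}
    (hc : ∀ z : A.domain, -c * ‖(z : E)‖ ^ 2 ≤ (inner ℂ (A z) (z : E)).re) (y : E) :
    ∃ z : A.domain, A z + ((c + 1 : ℝ) : ℂ) • (z : E) = y := by
  set μ : ℂ := ((c + 1 : ℝ) : ℂ) with hμ
  have hgraph : IsClosed (A.graph : Set (E × E)) := hA.isClosed
  have : CompleteSpace A.graph := hgraph.completeSpace_coe
  -- On the closed, hence complete, graph the map `A + μ` is bounded and bounded below, so its range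
  -- is closed.
  let T : A.graph →L[ℂ] E :=
    (ContinuousLinearMap.snd ℂ E E + μ • ContinuousLinearMap.fst ℂ E E) ∘L A.graph.subtypeL
  have hT : AntilipschitzWith (1 + ‖μ‖₊) T := by
    refine T.antilipschitz_of_bound fun p => ?_
    obtain ⟨⟨a, b⟩, hp⟩ := p
    obtain ⟨z, rfl, rfl⟩ := (LinearPMap.mem_graph_iff A).1 hp
    have h1 : T ⟨((z : E), A z), hp⟩ = A z + μ • (z : E) := rfl
    rw [h1]
    have h2 := norm_le_norm_add_smul hc z
    rw [← hμ] at h2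
    have h3 : ‖A z‖ ≤ ‖A z + μ • (z : E)‖ + ‖μ‖ * ‖(z : E)‖ := by
      have := norm_sub_le (A z + μ • (z : E)) (μ • (z : E))
      rwa [add_sub_cancel_right, norm_smul] at this
    change max ‖(z : E)‖ ‖A z‖ ≤ (1 + ‖μ‖) * _
    refine max_le ?_ ?_
    · nlinarith [norm_nonneg μ, norm_nonneg (A z + μ • (z : E))]
    · nlinarith [norm_nonneg μ, norm_nonneg (A z + μ • (z : E))]
  have hclosed : IsClosed (T.range : Set E) := hT.isClosed_range T.uniformContinuous
  have : CompleteSpace T.range := hclosed.completeSpace_coe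
  have htop : T.range = ⊤ := by
    rw [← Submodule.orthogonal_eq_bot_iff, Submodule.eq_bot_iff]
    intro w hw
    -- A vector orthogonal to the range lies in the domain of the adjoint, that is of `A`, and
    -- satisfies `A w = -μ w`; the lower bound then forces `w = 0`.
    have hw' : ∀ x : A.domain, inner ℂ (-μ • w) (x : E) = inner ℂ w (A x) := by
      intro x
      have h1 : inner ℂ w (A x + μ • (x : E)) = 0 := by
        refine Submodule.inner_left_of_mem_orthogonal (K := T.range) ?_ hw
        exact ⟨⟨((x : E), A x), LinearPMap.mem_graph A x⟩, rfl⟩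
      rw [inner_add_right, inner_smul_right] at h1
      rw [inner_smul_left, map_neg, hμ, Complex.conj_ofReal, ← hμ]
      linear_combination -h1
    have hmem : w ∈ A.adjoint.domain := LinearPMap.mem_adjoint_domain_of_exists w ⟨_, hw'⟩
    have happ := LinearPMap.adjoint_apply_eq hA.dense_domain ⟨w, hmem⟩ hw'
    obtain ⟨z, hz1, hz2⟩ : ∃ z : A.domain, (z : E) = w ∧ A z = -μ • w := by
      have hg : (w, -μ • w) ∈ A.adjoint.graph :=
        (LinearPMap.mem_graph_iff _).2 ⟨⟨w, hmem⟩, rfl, happ⟩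
      rw [LinearPMap.isSelfAdjoint_def.1 hA] at hg
      exact (LinearPMap.mem_graph_iff _).1 hg
    have h2 := norm_le_norm_add_smul hc z
    rw [hz2, hz1, ← hμ, neg_smul, neg_add_cancel, norm_zero] at h2
    exact norm_le_zero_iff.1 h2
  obtain ⟨⟨⟨a, b⟩, hp⟩, hy⟩ : y ∈ T.range := htop ▸ Submodule.mem_top
  obtain ⟨z, rfl, rfl⟩ := (LinearPMap.mem_graph_iff A).1 hp
  exact ⟨z, hy⟩

/-- The resolvent of a self-adjoint operator below its lower bound. -/
theorem exists_resolvent (hA : IsSelfAdjoint A) {c : ℝ}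
    (hc : ∀ z : A.domain, -c * ‖(z : E)‖ ^ 2 ≤ (inner ℂ (A z) (z : E)).re) :
    ∃ (S : E →ₗ[ℂ] A.domain) (R : E →L[ℂ] E), (∀ y, R y = S y) ∧ IsSelfAdjoint R ∧
      (∀ y, A (S y) + ((c + 1 : ℝ) : ℂ) • (S y : E) = y) ∧
      ∀ z, S (A z + ((c + 1 : ℝ) : ℂ) • (z : E)) = z := by
  set μ : ℂ := ((c + 1 : ℝ) : ℂ) with hμ
  let B : A.domain →ₗ[ℂ] E := A.toFun + μ • A.domain.subtype
  have hB : ∀ z, B z = A z + μ • (z : E) := fun z => rfl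
  have hinj : Function.Injective B := by
    rw [injective_iff_map_eq_zero]
    intro z hz
    have := norm_le_norm_add_smul hc z
    rw [← hμ, ← hB, hz, norm_zero] at this
    exact Subtype.ext (norm_le_zero_iff.1 this)
  have hsurj : Function.Surjective B := fun y => exists_add_smul_eq hA hc y
  let e := LinearEquiv.ofBijective B ⟨hinj, hsurj⟩
  have he : ∀ y, A (e.symm y) + μ • (e.symm y : E) = y := fun y => e.apply_symm_apply y
  let R : E →L[ℂ] E := (A.domain.subtype ∘ₗ (e.symm : E →ₗ[ℂ] A.domain)).mkContinuous 1 (by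
    intro y
    have := norm_le_norm_add_smul hc (e.symm y)
    rw [← hμ, he] at this
    simpa using this)
  refine ⟨e.symm, R, fun y => rfl, ?_, he, fun z => e.symm_apply_apply z⟩
  rw [ContinuousLinearMap.isSelfAdjoint_iff_isSymmetric]
  intro x y
  change inner ℂ (e.symm x : E) y = inner ℂ x (e.symm y : E)
  nth_rewrite 1 [← he y]
  nth_rewrite 2 [← he x]
  rw [inner_add_right, inner_add_left, inner_smul_left, inner_smul_right,
    symmetric_of_isSelfAdjoint hA, hμ, Complex.conj_ofReal]

/-- With `Q` the square root of `S`, the hypothesis says `‖Q x‖² = 0`. -/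
theorem apply_eq_zero_of_nonneg {S : E →L[ℂ] E} (hS : 0 ≤ S) {x : E}
    (hx : (inner ℂ (S x) x).re = 0) : S x = 0 := by
  obtain ⟨Q, hQ, hQ'⟩ : ∃ Q : E →L[ℂ] E, IsSelfAdjoint Q ∧ Q * Q = S :=
    ⟨CFC.sqrt S, (CFC.sqrt_nonneg S).isSelfAdjoint, CFC.sqrt_mul_sqrt_self S hS⟩
  rw [ContinuousLinearMap.isSelfAdjoint_iff_isSymmetric] at hQ
  by_contra h
  have hQx : Q x ≠ 0 := fun h0 => h (by rw [← hQ', mul_apply_eq_comp, h0, map_zero])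
  have := re_inner_self_pos hQx
  have h1 : inner ℂ (Q (Q x)) x = inner ℂ (Q x) (Q x) := hQ (Q x) x
  rw [← hQ', mul_apply_eq_comp, h1] at hx
  exact this.ne' hx

/-- A self-adjoint operator, bounded below and nonnegative on the kernel of a linear functional,
has a negative eigenvalue as soon as its form is negative somewhere. -/
theorem exists_neg_eigenvector (hA : IsSelfAdjoint A) {c : ℝ}
    (hc : ∀ z : A.domain, -c * ‖(z : E)‖ ^ 2 ≤ (inner ℂ (A z) (z : E)).re)
    (l : A.domain →ₗ[ℂ] ℂ) (hl : ∀ z, l z = 0 → 0 ≤ (inner ℂ (A z) (z : E)).re)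
    {z₀ : A.domain} (hz₀ : (inner ℂ (A z₀) (z₀ : E)).re < 0) :
    ∃ σ : ℝ, σ < 0 ∧ ∃ e : A.domain, e ≠ 0 ∧ A e = (σ : ℂ) • (e : E) := by
  obtain ⟨S, R, hRS, hR, hAS, hSA⟩ := exists_resolvent hA hc
  set μ : ℂ := ((c + 1 : ℝ) : ℂ) with hμ
  have hRsymm := hR.isSymmetric
  -- With `R = (A + μ)⁻¹` this is `R A R`: a bounded self-adjoint operator whose form at `w` is the
  -- form of `A` at `R w`.
  set T : E →L[ℂ] E := R - μ • (R * R) with hTdef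
  have hT : IsSelfAdjoint T := by
    rw [ContinuousLinearMap.isSelfAdjoint_iff_isSymmetric]
    intro x y
    have h1 : ∀ x y, inner ℂ (R x) y = inner ℂ x (R y) := hRsymm
    change inner ℂ (R x - μ • R (R x)) y = inner ℂ x (R y - μ • R (R y))
    rw [inner_sub_left, inner_sub_right, inner_smul_left, inner_smul_right, hμ,
      Complex.conj_ofReal, h1, h1, h1]
  have hform : ∀ w, inner ℂ (T w) w = inner ℂ (A (S w)) (S w : E) := by
    intro w
    have h1 : ∀ x y, inner ℂ (R x) y = inner ℂ x (R y) := hRsymm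
    have h2 : A (S w) = w - μ • R w := by rw [hRS]; exact eq_sub_of_add_eq (hAS w)
    rw [h2, ← hRS]
    change inner ℂ (R w - μ • R (R w)) w = _
    rw [inner_sub_left, inner_sub_left, inner_smul_left, inner_smul_left, h1, h1]
  have hneg : 0 ≤ T⁻ := CFC.negPart_nonneg T
  have hnegsymm : ∀ x y, inner ℂ (T⁻ x) y = inner ℂ x (T⁻ y) := hneg.isSelfAdjoint.isSymmetric
  have hTN : ∀ y, T (T⁻ y) = -T⁻ (T⁻ y) := by
    intro y
    have h1 : T⁺ * T⁻ = 0 := CFC.posPart_mul_negPart T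
    have h2 : T⁺ - T⁻ = T := CFC.posPart_sub_negPart T hT
    have h3 : T * T⁻ = -(T⁻ * T⁻) := by
      nth_rewrite 1 [← h2]
      rw [sub_mul, h1, zero_sub]
    simpa using congrArg (fun Q : E →L[ℂ] E => Q y) h3
  -- On the range of `T⁻` the operator `T` acts as `-T⁻`. The inequality is strict because `T⁻ (T⁻
  -- y) = 0` would give `‖T⁻ y‖² = 0` by symmetry.
  have hnegform : ∀ y, T⁻ y ≠ 0 → (inner ℂ (T (T⁻ y)) (T⁻ y)).re < 0 := by
    intro y hy
    have h1 : 0 ≤ (inner ℂ (T⁻ (T⁻ y)) (T⁻ y)).re :=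
      ((ContinuousLinearMap.nonneg_iff_isPositive _).1 hneg).re_inner_nonneg_left (T⁻ y)
    rw [hTN, inner_neg_left, Complex.neg_re, neg_lt_zero]
    refine h1.lt_of_ne fun h => ?_
    have h2 := apply_eq_zero_of_nonneg hneg h.symm
    have h3 := re_inner_self_pos hy
    rw [hnegsymm, ← hnegsymm, hnegsymm, h2, inner_zero_right] at h3
    simp at h3
  -- `T` is a polynomial in `R`, and `T⁻` comes from the functional calculus of `T`.
  have hcomm : Commute R T⁻ := by
    rw [CFC.negPart_def, cfcₙ_eq_cfc]
    refine (Commute.cfc_real (a := T) (b := R) ?_ _).symm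
    simp only [hTdef]
    exact (((Commute.refl R).sub_right (((Commute.refl R).mul_right
      (Commute.refl R)).smul_right μ))).symm
  have hTne : T⁻ ≠ 0 := by
    intro h0
    have h2 : T⁺ - T⁻ = T := CFC.posPart_sub_negPart T hT
    have h3 : 0 ≤ T := by
      rw [← h2, h0, sub_zero]; exact CFC.posPart_nonneg T
    have h4 := ((ContinuousLinearMap.nonneg_iff_isPositive _).1 h3).re_inner_nonneg_left
      (A z₀ + μ • (z₀ : E))
    rw [hform, hSA] at h4
    exact absurd hz₀ (not_lt.2 h4)
  obtain ⟨y₀, hy₀⟩ : ∃ y, T⁻ y ≠ 0 := by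
    by_contra! h
    exact hTne (ContinuousLinearMap.ext h)
  set e := T⁻ y₀ with he
  -- The range of `T⁻` is a line: otherwise a combination of two of its vectors would be a nonzero
  -- vector sent by `S` into the kernel of `l`, where the form is both negative and nonnegative.
  have hprop : ∀ y, ∃ ρ : ℂ, T⁻ y = ρ • e := by
    intro y
    refine ⟨l (S (T⁻ y)) / l (S e), ?_⟩
    have hle : l (S e) ≠ 0 := by
      intro h
      have := hl _ h
      rw [← hform] at this
      exact absurd (hnegform y₀ hy₀) (not_lt.2 this)
    set ρ := l (S (T⁻ y)) / l (S e) with hρ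
    have h1 : T⁻ (y - ρ • y₀) = T⁻ y - ρ • e := by rw [map_sub, map_smul]
    by_contra hne
    have h2 : T⁻ (y - ρ • y₀) ≠ 0 := by rwa [h1, sub_ne_zero]
    have h3 := hnegform _ h2
    have h4 : l (S (T⁻ (y - ρ • y₀))) = 0 := by
      rw [h1, map_sub, map_smul, map_sub, map_smul, smul_eq_mul, hρ, div_mul_cancel₀ _ hle, sub_self]
    have := hl _ h4
    rw [← hform] at this
    exact absurd h3 (not_lt.2 this)
  -- `R` commutes with `T⁻` and so preserves this line; its generator is an eigenvector of the
  -- resolvent, hence of `A`.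
  obtain ⟨ρ, hρ⟩ : ∃ ρ : ℂ, R e = ρ • e := by
    obtain ⟨ρ, hρ⟩ := hprop (R y₀)
    refine ⟨ρ, ?_⟩
    rw [← hρ, he]
    exact congrArg (fun Q : E →L[ℂ] E => Q y₀) hcomm.eq
  have hρ0 : ρ ≠ 0 := by
    rintro rfl
    have h1 : S e = 0 := Subtype.ext (by rw [← hRS, hρ, zero_smul]; rfl)
    have := hAS e
    rw [h1, LinearPMap.map_zero, Submodule.coe_zero, smul_zero, add_zero] at this
    exact hy₀ this.symm
  set v : A.domain := ρ⁻¹ • S e with hv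
  have hve : (v : E) = e := by
    rw [hv, Submodule.coe_smul, ← hRS, hρ, smul_smul, inv_mul_cancel₀ hρ0, one_smul]
  have hAv : A v = (ρ⁻¹ - μ) • (v : E) := by
    have h1 : A v + μ • (v : E) = ρ⁻¹ • e := by
      rw [hv, LinearPMap.map_smul, Submodule.coe_smul, smul_comm μ, ← smul_add, hAS]
    rw [sub_smul, hve, ← h1, hve, add_sub_cancel_right]
  have hv0 : (v : E) ≠ 0 := hve ▸ hy₀
  set s := ρ⁻¹ - μ with hs
  have hss : conj s = s := by
    have h1 := symmetric_of_isSelfAdjoint hA v v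
    rw [hAv, inner_smul_left, inner_smul_right] at h1
    exact mul_right_cancel₀ (inner_self_ne_zero.2 hv0) h1
  obtain ⟨σ, hσ⟩ := Complex.conj_eq_iff_real.1 hss
  refine ⟨σ, ?_, v, fun h => hv0 (by rw [h]; rfl), by rw [← hσ, hAv]⟩
  have h1 := hnegform y₀ hy₀
  rw [hform] at h1
  have h2 : S e = ρ • v := by rw [hv, smul_smul, mul_inv_cancel₀ hρ0, one_smul]
  rw [h2, LinearPMap.map_smul, Submodule.coe_smul, inner_smul_left, inner_smul_right, hAv, hσ, inner_smul_left,
    Complex.conj_ofReal, ← mul_assoc, mul_comm (conj ρ), Complex.mul_conj, ← mul_assoc,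
    ← Complex.ofReal_mul, Complex.re_ofReal_mul] at h1
  have h3 := re_inner_self_pos hv0
  have h4 : 0 < Complex.normSq ρ := Complex.normSq_pos.2 hρ0
  by_contra hge
  have := mul_nonneg (mul_nonneg h4.le (not_lt.1 hge)) h3.le
  linarith

/-- Eigenvectors for distinct eigenvalues are orthogonal, so the form would be negative on a
combination of them chosen in the kernel of `l`. -/
theorem neg_eigenvalue_unique (hA : IsSelfAdjoint A) (l : A.domain →ₗ[ℂ] ℂ)
    (hl : ∀ z, l z = 0 → 0 ≤ (inner ℂ (A z) (z : E)).re) {σ τ : ℝ} (hσ : σ < 0) (hτ : τ < 0)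
    {e f : A.domain} (he : e ≠ 0) (hAe : A e = (σ : ℂ) • (e : E))
    (hf : f ≠ 0) (hAf : A f = (τ : ℂ) • (f : E)) : τ = σ := by
  by_contra hne
  have horth : inner ℂ (e : E) (f : E) = 0 := by
    have h1 := symmetric_of_isSelfAdjoint hA e f
    rw [hAe, hAf, inner_smul_left, inner_smul_right, Complex.conj_ofReal] at h1
    have h2 : ((τ : ℂ) - σ) * inner ℂ (e : E) (f : E) = 0 := by linear_combination -h1
    exact (mul_eq_zero.1 h2).resolve_left (sub_ne_zero.2 (by exact_mod_cast hne))
  have horth' : inner ℂ (f : E) (e : E) = 0 := inner_eq_zero_symm.1 horth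
  have hle : l e ≠ 0 := fun h => absurd (inner_eigenvector_neg hσ he hAe) (not_lt.2 (hl e h))
  set a : ℂ := l f with ha
  set b : ℂ := -l e with hb
  have h1 := hl (a • e + b • f) (by
    rw [map_add, map_smul, map_smul, smul_eq_mul, smul_eq_mul, ← ha, hb]; ring)
  have h2 : inner ℂ (A (a • e + b • f)) ((a • e + b • f : A.domain) : E) =
      ((Complex.normSq a * σ : ℝ) : ℂ) * inner ℂ (e : E) (e : E) +
        ((Complex.normSq b * τ : ℝ) : ℂ) * inner ℂ (f : E) (f : E) := by
    rw [LinearPMap.map_add, LinearPMap.map_smul, LinearPMap.map_smul, hAe, hAf, Submodule.coe_add, Submodule.coe_smul,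
      Submodule.coe_smul]
    simp only [inner_add_left, inner_add_right, inner_smul_left, inner_smul_right, horth, horth',
      Complex.conj_ofReal, Complex.ofReal_mul, Complex.normSq_eq_conj_mul_self]
    ring
  rw [h2, Complex.add_re, Complex.re_ofReal_mul, Complex.re_ofReal_mul] at h1
  have h3 := re_inner_self_pos (x := (e : E)) fun h0 => he (Subtype.ext h0)
  have h4 := re_inner_self_pos (x := (f : E)) fun h0 => hf (Subtype.ext h0)
  have h5 : 0 < Complex.normSq b := Complex.normSq_pos.2 (neg_ne_zero.2 hle)
  have h6 := mul_nonneg (Complex.normSq_nonneg a) h3.le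
  have h7 := mul_pos h5 h4
  nlinarith

end Abstract

/-! ### Sobolev functions on the line -/

section Sobolev

open FourierTransform
open scoped ContDiff

/-- The Bessel potential of order 2 has symbol `1 + x²`, without factors of `2π`, while `∂²` has
symbol `(2πi)² x²`; so the potential is `1 + (2πi)⁻² ∂²`. -/
theorem memSobolev_two_add {s : ℝ} {f : 𝓢'(ℝ, ℂ)} (hf : MemSobolev s 2 f)
    (h : MemSobolev s 2 (∂_{(1 : ℝ)} (∂_{(1 : ℝ)} f))) : MemSobolev (2 + s) 2 f := by
  rw [← memSobolev_besselPotential_iff]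
  have h1 : ∂_{(1 : ℝ)} (∂_{(1 : ℝ)} f) = ((2 * Real.pi * Complex.I) ^ 2) •
      TemperedDistribution.fourierMultiplierCLM ℂ (fun x : ℝ => ((x ^ 2 : ℝ) : ℂ)) f := by
    rw [lineDeriv_eq_fourierMultiplierCLM, lineDeriv_eq_fourierMultiplierCLM, map_smul,
      fourierMultiplierCLM_fourierMultiplierCLM_apply (by fun_prop) (by fun_prop), smul_smul,
      ← sq]
    congr 2
    congr 1
    funext x
    simp [sq]
  have h2 : besselPotential ℝ ℂ 2 f =
      f + ((2 * Real.pi * Complex.I) ^ 2)⁻¹ • ∂_{(1 : ℝ)} (∂_{(1 : ℝ)} f) := by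
    have hne : (2 * Real.pi * Complex.I) ^ 2 ≠ 0 := by
      simp [Real.pi_ne_zero]
    rw [h1, smul_smul, inv_mul_cancel₀ hne, one_smul]
    nth_rewrite 2 [← ContinuousLinearMap.id_apply (R₁ := ℂ) f]
    rw [← besselPotential_zero, besselPotential, besselPotential,
      TemperedDistribution.fourierMultiplierCLM_apply,
      TemperedDistribution.fourierMultiplierCLM_apply,
      TemperedDistribution.fourierMultiplierCLM_apply, ← FourierTransform.fourierInv_add,
      ← add_apply, ← smulLeftCLM_add (by fun_prop) (by fun_prop)]
    congr 3
    funext x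
    simp
  rw [h2]
  exact hf.add (h.smul _)

theorem memSobolev_zero_coe (f : L2) : MemSobolev 0 2 (f : 𝓢'(ℝ, ℂ)) :=
  memSobolev_zero_iff.2 ⟨f, rfl⟩

theorem mem_H1_of_lineDeriv {f g : L2} (h : ∂_{(1 : ℝ)} (f : 𝓢'(ℝ, ℂ)) = (g : 𝓢'(ℝ, ℂ))) :
    f ∈ H1 := by
  -- Two derivatives are gained starting from regularity `-1`, where both `f` and `∂² f = ∂ g` lie.
  have h1 : MemSobolev (2 + -1) 2 (f : 𝓢'(ℝ, ℂ)) := by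
    refine memSobolev_two_add ((memSobolev_zero_coe f).mono (by norm_num)) ?_
    rw [h]
    simpa using (memSobolev_zero_coe g).lineDerivOp (m := (1 : ℝ))
  norm_num at h1
  exact h1

theorem mem_H2_of_weakDeriv {f : L2} (hf : f ∈ H1) (h : weakDeriv f ∈ H1) : f ∈ H2 := by
  have h1 : MemSobolev (2 + 0) 2 (f : 𝓢'(ℝ, ℂ)) := by
    refine memSobolev_two_add (memSobolev_zero_coe f) ?_
    rw [coe_weakDeriv hf, coe_weakDeriv h]
    exact memSobolev_zero_coe _
  rw [add_zero] at h1
  exact h1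

/-- The pairing form of the weak derivative. -/
theorem lineDeriv_eq_iff {f g : L2} : ∂_{(1 : ℝ)} (f : 𝓢'(ℝ, ℂ)) = (g : 𝓢'(ℝ, ℂ)) ↔
    ∀ θ : 𝓢(ℝ, ℂ), ∫ x, (∂_{(1 : ℝ)} θ) x * f x = -∫ x, θ x * g x := by
  constructor
  · intro h θ
    have h1 := congrArg (fun T : 𝓢'(ℝ, ℂ) => T θ) h
    simp only [lineDerivOp_apply_apply, Lp.toTemperedDistribution_apply, smul_eq_mul, map_neg] at h1
    rw [← h1, neg_neg]
  · intro h
    ext θ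
    simp only [lineDerivOp_apply_apply, Lp.toTemperedDistribution_apply, smul_eq_mul, map_neg]
    rw [h θ, neg_neg]

/-- Complex conjugation of Schwartz functions. -/
def conjSchwartz (θ : 𝓢(ℝ, ℂ)) : 𝓢(ℝ, ℂ) :=
  θ.postcompCLM (𝕜 := ℝ) (Complex.conjCLE : ℂ →L[ℝ] ℂ)

theorem conjSchwartz_apply (θ : 𝓢(ℝ, ℂ)) (x : ℝ) : conjSchwartz θ x = conj (θ x) := rfl

theorem lineDeriv_conjSchwartz (θ : 𝓢(ℝ, ℂ)) (x : ℝ) :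
    (∂_{(1 : ℝ)} (conjSchwartz θ)) x = conj ((∂_{(1 : ℝ)} θ) x) := by
  rw [SchwartzMap.lineDerivOp_apply_eq_fderiv, SchwartzMap.lineDerivOp_apply_eq_fderiv]
  have h : (conjSchwartz θ : ℝ → ℂ) = (Complex.conjCLE : ℂ →L[ℝ] ℂ) ∘ θ := rfl
  rw [h, fderiv_comp x (ContinuousLinearMap.differentiableAt _) θ.differentiableAt]
  rw [ContinuousLinearMap.fderiv]
  rfl

theorem lineDeriv_star {f g : L2} (h : ∂_{(1 : ℝ)} (f : 𝓢'(ℝ, ℂ)) = (g : 𝓢'(ℝ, ℂ))) :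
    ∂_{(1 : ℝ)} ((star f : L2) : 𝓢'(ℝ, ℂ)) = ((star g : L2) : 𝓢'(ℝ, ℂ)) := by
  rw [lineDeriv_eq_iff] at h ⊢
  intro θ
  have h1 := congrArg conj (h (conjSchwartz θ))
  rw [map_neg, ← integral_conj, ← integral_conj] at h1
  simp only [lineDeriv_conjSchwartz, conjSchwartz_apply, map_mul, Complex.conj_conj] at h1
  calc _ = ∫ x, (∂_{(1 : ℝ)} θ) x * conj (f x) := by
        refine integral_congr_ae ?_
        filter_upwards [Lp.coeFn_star f] with x hx
        rw [hx]; rfl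
    _ = _ := h1
    _ = _ := by
        congr 1
        refine integral_congr_ae ?_
        filter_upwards [Lp.coeFn_star g] with x hx
        rw [hx]; rfl

theorem star_mem_H1 {f : L2} (hf : f ∈ H1) : star f ∈ H1 :=
  mem_H1_of_lineDeriv (lineDeriv_star (coe_weakDeriv hf))

theorem weakDeriv_star {f : L2} (hf : f ∈ H1) : weakDeriv (star f) = star (weakDeriv f) :=
  weakDeriv_eq (lineDeriv_star (coe_weakDeriv hf))

theorem star_mem_H2 {f : L2} (hf : f ∈ H2) : star f ∈ H2 := by
  refine mem_H2_of_weakDeriv (star_mem_H1 (H2_le_H1 hf)) ?_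
  rw [weakDeriv_star (H2_le_H1 hf)]
  exact star_mem_H1 (weakDeriv_mem_H1 hf)

theorem inner_eq_integral (f g : L2) : inner ℂ f g = ∫ x, conj (f x) * g x := by
  rw [L2.inner_def]
  refine integral_congr_ae (.of_forall fun x => ?_)
  simp only [RCLike.inner_apply]
  ring

/-- Locally integrable functions with the same pairings with Schwartz functions agree. -/
theorem ae_eq_of_forall_schwartz {f g : ℝ → ℂ} (hf : LocallyIntegrable f volume)
    (hg : LocallyIntegrable g volume)
    (h : ∀ θ : 𝓢(ℝ, ℂ), ∫ x, θ x * f x = ∫ x, θ x * g x) : f =ᵐ[volume] g := by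
  refine ae_eq_of_integral_contDiff_smul_eq hf hg fun θ hθ hθc => ?_
  have h₁ : HasCompactSupport (Complex.ofRealCLM ∘ θ) := hθc.comp_left rfl
  have h₂ : ContDiff ℝ ∞ (Complex.ofRealCLM ∘ θ) := by fun_prop
  simpa using h (h₁.toSchwartzMap h₂)

/-- The Fourier transform turns the weak derivative into a multiplication. -/
theorem fourier_weakDeriv {f : L2} (hf : f ∈ H1) :
    (𝓕 (weakDeriv f) : L2) =ᵐ[volume] fun x => (2 * Real.pi * Complex.I) * x * (𝓕 f : L2) x := by
  have h := congrArg (fun T : 𝓢'(ℝ, ℂ) => 𝓕 T) (coe_weakDeriv hf)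
  simp only [fourier_lineDerivOp_eq, Lp.fourier_toTemperedDistribution_eq] at h
  have hid : Continuous fun x : ℝ => (2 * Real.pi * Complex.I) * (x : ℂ) := by fun_prop
  symm
  refine ae_eq_of_forall_schwartz ?_ ?_ fun θ => ?_
  · exact ((Lp.memLp (𝓕 f : L2)).locallyIntegrable (by norm_num)).continuous_mul hid
  · exact (Lp.memLp _).locallyIntegrable (by norm_num)
  · have h1 := congrArg (fun T : 𝓢'(ℝ, ℂ) => T θ) h
    simp only [smul_apply, smulLeftCLM_apply_apply, Lp.toTemperedDistribution_apply,
      smul_eq_mul] at h1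
    rw [← h1, ← integral_const_mul]
    refine integral_congr_ae (.of_forall fun x => ?_)
    simp only [SchwartzMap.smulLeftCLM_apply_apply
      (show (fun x : ℝ => ((inner ℝ x 1 : ℝ) : ℂ)).HasTemperateGrowth by fun_prop), smul_eq_mul]
    simp
    ring

/-- Integration by parts. -/
theorem inner_weakDeriv {f g : L2} (hf : f ∈ H1) (hg : g ∈ H1) :
    inner ℂ (weakDeriv f) g = -inner ℂ f (weakDeriv g) := by
  -- By Plancherel this becomes the fact that the symbol `2πi x` is purely imaginary.
  rw [← Lp.inner_fourier_eq, ← Lp.inner_fourier_eq f, inner_eq_integral, inner_eq_integral,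
    ← integral_neg]
  refine integral_congr_ae ?_
  filter_upwards [fourier_weakDeriv hf, fourier_weakDeriv hg] with x h1 h2
  rw [h1, h2]
  simp only [map_mul, map_ofNat, Complex.conj_ofReal, Complex.conj_I]
  ring

/-- `H¹(ℝ) ⊂ L^∞(ℝ)`. -/
theorem memLp_top_of_mem_H1 {f : L2} (hf : f ∈ H1) : MemLp f ∞ volume := by
  -- The Fourier transform of `f` is integrable, so `f` agrees almost everywhere with an absolutely
  -- convergent inverse Fourier integral.
  obtain ⟨v, hv⟩ := MemSobolev.fourier_memL1 (by simp) (show MemSobolev 1 2 (f : 𝓢'(ℝ, ℂ)) from hf)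
  have hvi : Integrable (v : ℝ → ℂ) := memLp_one_iff_integrable.1 (Lp.memLp v)
  set g : ℝ → ℂ := 𝓕⁻ (v : ℝ → ℂ) with hg
  have hgc : Continuous g :=
    VectorFourier.fourierIntegral_continuous Real.continuous_fourierChar
      (by fun_prop) hvi
  have hgb : ∀ x, ‖g x‖ ≤ ∫ x, ‖v x‖ := fun x =>
    VectorFourier.norm_fourierIntegral_le_integral_norm _ _ _ _ _
  have hfg : f =ᵐ[volume] g := by
    refine ae_eq_of_forall_schwartz ((Lp.memLp f).locallyIntegrable (by norm_num))
      hgc.locallyIntegrable fun θ => ?_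
    have h1 := congrArg (fun T : 𝓢'(ℝ, ℂ) => T (𝓕⁻ θ)) hv
    simp only [TemperedDistribution.fourier_apply, FourierTransform.fourier_fourierInv_eq,
      Lp.toTemperedDistribution_apply, smul_eq_mul] at h1
    rw [h1]
    have h2 := VectorFourier.integral_fourierIntegral_smul_eq_flip (L := -innerₗ ℝ) (μ := volume)
      (ν := volume) Real.continuous_fourierChar (by fun_prop) θ.integrable hvi
    have hflip : (-innerₗ ℝ).flip = -innerₗ ℝ := by
      ext
      simp
    rw [hflip] at h2
    rw [SchwartzMap.fourierInv_coe]
    exact h2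

  rw [memLp_congr_ae hfg]
  exact memLp_top_of_bound hgc.aestronglyMeasurable _ (.of_forall hgb)

theorem toLp_mem_H2 (θ : 𝓢(ℝ, ℂ)) : (θ.toLp 2 : L2) ∈ H2 := by
  have h : ((θ.toLp 2 : L2) : 𝓢'(ℝ, ℂ)) = θ.toTemperedDistributionCLM ℝ ℂ volume :=
    Lp.toTemperedDistribution_toLp_eq θ
  have h1 : MemSobolev 2 2 ((θ.toLp 2 : L2) : 𝓢'(ℝ, ℂ)) := by
    rw [h]
    exact θ.memSobolev
  exact h1

theorem dense_H2 : Dense (H2 : Set L2) := by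
  have h := SchwartzMap.denseRange_toLpCLM (E := ℝ) (F := ℂ) (p := 2)
    (μ := volume) ENNReal.ofNat_ne_top
  refine h.mono ?_
  rintro _ ⟨θ, rfl⟩
  exact toLp_mem_H2 θ

theorem weakDeriv_toLp (θ : 𝓢(ℝ, ℂ)) : weakDeriv (θ.toLp 2) = (∂_{(1 : ℝ)} θ).toLp 2 := by
  refine weakDeriv_eq ?_
  rw [Lp.toTemperedDistribution_toLp_eq, Lp.toTemperedDistribution_toLp_eq,
    lineDerivOp_toTemperedDistributionCLM_eq]

end Sobolev

/-! ### Self-adjointness of the linearized operator -/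

theorem inner_toLp (f : L2) (θ : 𝓢(ℝ, ℂ)) :
    inner ℂ f (θ.toLp 2) = ((star f : L2) : 𝓢'(ℝ, ℂ)) θ := by
  rw [inner_eq_integral, Lp.toTemperedDistribution_apply]
  refine integral_congr_ae ?_
  filter_upwards [Lp.coeFn_star f, θ.coeFn_toLp 2 volume] with x h1 h2
  rw [h1, h2, smul_eq_mul, mul_comm]
  rfl

/-- The hypothesis says that a second distributional derivative lies in `L²`. The inner product is
conjugate linear in its first slot, so the distribution involved is that of `star f`. -/
theorem mem_H2_of_inner {f g : L2} (h : ∀ θ : 𝓢(ℝ, ℂ),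
    inner ℂ f ((∂_{(1 : ℝ)} (∂_{(1 : ℝ)} θ)).toLp 2) = inner ℂ g (θ.toLp 2)) : f ∈ H2 := by
  rw [← star_star f]
  refine star_mem_H2 ?_
  have h1 : ∂_{(1 : ℝ)} (∂_{(1 : ℝ)} ((star f : L2) : 𝓢'(ℝ, ℂ))) = ((star g : L2) : 𝓢'(ℝ, ℂ)) := by
    ext θ
    rw [← inner_toLp, ← h, inner_toLp, lineDerivOp_apply_apply, lineDerivOp_apply_apply,
      LineDeriv.lineDerivOp_neg, neg_neg]
  have h2 : MemSobolev (2 + 0) 2 ((star f : L2) : 𝓢'(ℝ, ℂ)) := by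
    refine memSobolev_two_add (memSobolev_zero_coe _) ?_
    rw [h1]
    exact memSobolev_zero_coe _
  rw [add_zero] at h2
  exact h2

theorem potential_symm (a b : ℝ) (i j : Fin 4) : potential a b i j = potential a b j i := by
  fin_cases i <;> fin_cases j <;> rfl

theorem weakDeriv_zero : weakDeriv 0 = 0 := by simpa using weakDeriv_smul 0 H1.zero_mem

/-- Entries quadratic in `(a, b)` give both boundedness of the potential for bounded waves and its
scaling under multiples of `(a, b)`. -/
theorem exists_potential_eq : ∃ M₁ M₂ M₃ : Matrix (Fin 4) (Fin 4) ℝ, ∀ a b i j,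
    potential a b i j = M₁ i j * a ^ 2 + M₂ i j * (a * b) + M₃ i j * b ^ 2 := by
  refine ⟨!![-18, 0, -6, 0; 0, -6, 0, -6; -6, 0, -12, 0; 0, -6, 0, -12],
    !![-12, 0, -24, 0; 0, 12, 0, 0; -24, 0, 0, 0; 0, 0, 0, 0],
    !![-12, 0, 0, 0; 0, -12, 0, 0; 0, 0, -18, 0; 0, 0, 0, -6], fun a b i j => ?_⟩
  fin_cases i <;> fin_cases j <;> simp [potential] <;> ring

theorem exists_ae_abs_le_of_memLp_top {f : ℝ → ℝ} (hf : MemLp f ∞ volume) :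
    ∃ K : ℝ, ∀ᵐ x : ℝ, |f x| ≤ K := by
  refine ⟨(eLpNormEssSup f volume).toReal, ?_⟩
  filter_upwards [enorm_ae_le_eLpNormEssSup f volume] with x hx
  have h : eLpNormEssSup f volume ≠ ∞ := by
    rw [← eLpNorm_exponent_top]; exact hf.2.ne
  simpa using ENNReal.toReal_mono h hx

section

variable {φ ψ : ℝ → ℝ} (hφ : MemLp φ ∞ volume) (hψ : MemLp ψ ∞ volume)

include hφ hψ

theorem memLp_potential (i j : Fin 4) :
    MemLp (fun x => potential (φ x) (ψ x) i j) ∞ volume := by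
  obtain ⟨M₁, M₂, M₃, h⟩ := exists_potential_eq
  simp only [h]
  have h1 : MemLp (fun x => φ x * φ x) ∞ volume := hφ.mul hφ
  have h2 : MemLp (fun x => φ x * ψ x) ∞ volume := hψ.mul hφ
  have h3 : MemLp (fun x => ψ x * ψ x) ∞ volume := hψ.mul hψ
  simp only [sq]
  exact ((h1.const_mul _).add (h2.const_mul _)).add (h3.const_mul _)

theorem memLp_potentialMul (z : L24) (i : Fin 4) :
    MemLp (potentialMul φ ψ z i) 2 volume := by
  unfold potentialMul
  refine memLp_finsetSum _ fun j _ => ?_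
  exact (Lp.memLp (z j)).mul (memLp_potential hφ hψ i j).ofReal

omit hφ hψ in
/-- Multiplication by the matrix potential. -/
def potentialOp (hφ : MemLp φ ∞ volume) (hψ : MemLp ψ ∞ volume) (z : L24) : L24 :=
  WithLp.toLp 2 fun i => (memLp_potentialMul hφ hψ z i).toLp _

theorem mem_linOp_domain_iff (ω : ℝ) (z : L24) :
    z ∈ (linOp ω φ ψ).domain ↔ ∀ i, z i ∈ H2 :=
  ⟨fun h => h.1, fun h => ⟨h, memLp_potentialMul hφ hψ z⟩⟩

theorem linOp_apply (ω : ℝ) (z : (linOp ω φ ψ).domain) (i : Fin 4) :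
    linOp ω φ ψ z i = -weakDeriv (weakDeriv ((z : L24) i)) + (massCoeff ω i : ℂ) • (z : L24) i
      + potentialOp hφ hψ z i := rfl

theorem integrable_potential_form (z w : L24) (i : Fin 4) : Integrable (fun x =>
    conj (potentialMul φ ψ z i x) * w i x) volume := by
  have h := (L2.integrable_inner (𝕜 := ℂ) ((memLp_potentialMul hφ hψ z i).toLp _) (w i))
  refine h.congr ?_
  filter_upwards [(memLp_potentialMul hφ hψ z i).coeFn_toLp] with x hx
  rw [hx, RCLike.inner_apply, mul_comm]

theorem inner_potentialOp (z w : L24) : inner ℂ (potentialOp hφ hψ z) w =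
    ∫ x, ∑ i, ∑ j, (potential (φ x) (ψ x) i j : ℂ) * (conj (z j x) * w i x) := by
  rw [PiLp.inner_apply]
  have h : ∀ i, inner ℂ (potentialOp hφ hψ z i) (w i) =
      ∫ x, conj (potentialMul φ ψ z i x) * w i x := by
    intro i
    rw [inner_eq_integral]
    refine integral_congr_ae ?_
    filter_upwards [(memLp_potentialMul hφ hψ z i).coeFn_toLp] with x hx
    have : (potentialOp hφ hψ z i : ℝ → ℂ) x = potentialMul φ ψ z i x := hx
    rw [this]
  rw [Finset.sum_congr rfl fun i _ => h i,
    ← integral_finsetSum _ fun i _ => integrable_potential_form hφ hψ z w i]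
  refine integral_congr_ae (.of_forall fun x => ?_)
  refine Finset.sum_congr rfl fun i _ => ?_
  simp only [potentialMul, map_sum, map_mul, Complex.conj_ofReal, Finset.sum_mul, mul_assoc]

theorem potentialOp_symm (z w : L24) :
    inner ℂ (potentialOp hφ hψ z) w = inner ℂ z (potentialOp hφ hψ w) := by
  rw [← inner_conj_symm z, inner_potentialOp, inner_potentialOp, ← integral_conj]
  refine integral_congr_ae (.of_forall fun x => ?_)
  simp only [map_sum, map_mul, Complex.conj_ofReal, Complex.conj_conj]
  rw [Finset.sum_comm]
  refine Finset.sum_congr rfl fun i _ => Finset.sum_congr rfl fun j _ => ?_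
  rw [potential_symm]
  ring

/-- The sesquilinear form of the linearized operator. -/
theorem inner_linOp (ω : ℝ) (z : (linOp ω φ ψ).domain) {w : L24} (hw : ∀ i, w i ∈ H1) :
    inner ℂ (linOp ω φ ψ z) w = ∑ i, (inner ℂ (weakDeriv ((z : L24) i)) (weakDeriv (w i)) +
      massCoeff ω i * inner ℂ ((z : L24) i) (w i)) + inner ℂ (potentialOp hφ hψ z) w := by
  rw [PiLp.inner_apply, PiLp.inner_apply, ← Finset.sum_add_distrib]
  refine Finset.sum_congr rfl fun i _ => ?_
  rw [linOp_apply hφ hψ, inner_add_left, inner_add_left, inner_neg_left, inner_smul_left,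
    Complex.conj_ofReal, inner_weakDeriv (weakDeriv_mem_H1 (z.2.1 i)) (hw i), neg_neg]

theorem linOp_symm (ω : ℝ) (z w : (linOp ω φ ψ).domain) :
    inner ℂ (linOp ω φ ψ z) (w : L24) = inner ℂ (z : L24) (linOp ω φ ψ w) := by
  rw [← inner_conj_symm (z : L24), inner_linOp hφ hψ ω z fun i => H2_le_H1 (w.2.1 i),
    inner_linOp hφ hψ ω w fun i => H2_le_H1 (z.2.1 i), map_add, inner_conj_symm,
    ← potentialOp_symm, map_sum]
  simp only [map_add, map_mul, Complex.conj_ofReal, inner_conj_symm]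

theorem dense_linOp_domain (ω : ℝ) : Dense ((linOp ω φ ψ).domain : Set L24) := by
  have h := dense_pi Set.univ fun (_ : Fin 4) _ => dense_H2
  have h2 := h.preimage (PiLp.continuousLinearEquiv 2 ℂ (fun _ : Fin 4 => L2)).toHomeomorph.isOpenMap
  refine h2.mono fun z hz => ?_
  exact (mem_linOp_domain_iff hφ hψ ω z).2 fun i => hz i (Set.mem_univ i)

/-- Symmetry gives one inclusion. For the other, testing the adjoint relation on Schwartz functions
in a single component shows that each component of a vector in the adjoint domain has its second
derivative in `L²`. -/
theorem isSelfAdjoint_linOp (ω : ℝ) : IsSelfAdjoint (linOp ω φ ψ) := by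
  have hd := dense_linOp_domain hφ hψ ω
  have hle : linOp ω φ ψ ≤ (linOp ω φ ψ).adjoint :=
    LinearPMap.IsFormalAdjoint.le_adjoint hd (linOp_symm hφ hψ ω)
  rw [LinearPMap.isSelfAdjoint_def]
  refine (LinearPMap.eq_of_le_of_domain_eq hle (le_antisymm hle.1 fun y hy => ?_)).symm
  rw [mem_linOp_domain_iff hφ hψ]
  intro i
  set w : L24 := (linOp ω φ ψ).adjoint ⟨y, hy⟩ with hw
  refine mem_H2_of_inner (g := (massCoeff ω i : ℂ) • y i + potentialOp hφ hψ y i - w i) fun θ => ?_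
  set x : L24 := WithLp.toLp 2 (Pi.single i (θ.toLp 2)) with hx
  have hxi : x i = θ.toLp 2 := by simp [hx]
  have hxj : ∀ j, j ≠ i → x j = 0 := fun j hj => by simp [hx, hj]
  have hmem : x ∈ (linOp ω φ ψ).domain := by
    rw [mem_linOp_domain_iff hφ hψ]
    intro j
    by_cases hj : j = i
    · subst hj; rw [hxi]; exact toLp_mem_H2 θ
    · rw [hxj j hj]; exact H2.zero_mem
  have h1 : inner ℂ w x = inner ℂ y (linOp ω φ ψ ⟨x, hmem⟩) :=
    LinearPMap.adjoint_isFormalAdjoint hd ⟨y, hy⟩ ⟨x, hmem⟩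
  have h2 : inner ℂ y (linOp ω φ ψ ⟨x, hmem⟩) =
      inner ℂ (y i) (-weakDeriv (weakDeriv (x i)) + (massCoeff ω i : ℂ) • x i) +
        inner ℂ (potentialOp hφ hψ y) x := by
    rw [potentialOp_symm, PiLp.inner_apply, PiLp.inner_apply,
      Finset.sum_congr rfl fun j _ => by rw [linOp_apply hφ hψ, inner_add_right],
      Finset.sum_add_distrib]
    congr 1
    refine Finset.sum_eq_single i (fun j _ hj => ?_) (fun h => absurd (Finset.mem_univ i) h)
    simp [hxj j hj, weakDeriv_zero]
  have h3 : ∀ v : L24, inner ℂ v x = inner ℂ (v i) (x i) := by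
    intro v
    rw [PiLp.inner_apply]
    refine Finset.sum_eq_single i (fun j _ hj => ?_) (fun h => absurd (Finset.mem_univ i) h)
    rw [hxj j hj, inner_zero_right]
  rw [h2, h3, h3, hxi, weakDeriv_toLp, weakDeriv_toLp, inner_add_right, inner_neg_right,
    inner_smul_right] at h1
  rw [inner_sub_left, inner_add_left, inner_smul_left, Complex.conj_ofReal, h1]
  ring

theorem integrable_potential_quadratic (z w : L24) : Integrable (fun x =>
    ∑ i, ∑ j, (potential (φ x) (ψ x) i j : ℂ) * (conj (z j x) * w i x)) volume := by
  refine (integrable_finsetSum Finset.univ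
    fun i _ => integrable_potential_form hφ hψ z w i).congr
    (.of_forall fun x => ?_)
  refine Finset.sum_congr rfl fun i _ => ?_
  simp only [potentialMul, map_sum, map_mul, Complex.conj_ofReal, Finset.sum_mul, mul_assoc]

omit hφ hψ in
theorem integrable_norm_sq (f : L2) : Integrable (fun x => ‖f x‖ ^ 2) volume :=
  (memLp_two_iff_integrable_sq_norm (Lp.aestronglyMeasurable f)).1 (Lp.memLp f)

omit hφ hψ in
theorem norm_sq_eq_integral (f : L2) : ‖f‖ ^ 2 = ∫ x, ‖f x‖ ^ 2 := by
  have h1 : (inner ℂ f f).re = ‖f‖ ^ 2 := by simpa using inner_self_eq_norm_sq (𝕜 := ℂ) f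
  rw [← h1, inner_eq_integral]
  have h2 : ∀ x, conj (f x) * f x = ((‖f x‖ ^ 2 : ℝ) : ℂ) := fun x => by
    rw [Complex.conj_mul']; push_cast; rfl
  simp only [h2]
  rw [integral_complex_ofReal, Complex.ofReal_re]

theorem integrable_re_potential_quadratic (z w : L24) : Integrable (fun x =>
    ∑ i, ∑ j, potential (φ x) (ψ x) i j * (conj (z j x) * w i x).re) volume := by
  refine (integrable_potential_quadratic hφ hψ z w).re.congr (.of_forall fun x => ?_)
  simp only [RCLike.re_eq_complex_re, Complex.re_sum, Complex.re_ofReal_mul]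

theorem re_inner_potentialOp (z w : L24) : (inner ℂ (potentialOp hφ hψ z) w).re =
    ∫ x, ∑ i, ∑ j, potential (φ x) (ψ x) i j * (conj (z j x) * w i x).re := by
  rw [inner_potentialOp]
  refine (integral_re (integrable_potential_quadratic hφ hψ z w)).symm.trans ?_
  refine integral_congr_ae (.of_forall fun x => ?_)
  simp only [RCLike.re_eq_complex_re, Complex.re_sum, Complex.re_ofReal_mul]

theorem exists_potential_lower_bound : ∃ c : ℝ, ∀ z : L24,
    -c * ‖z‖ ^ 2 ≤ (inner ℂ (potentialOp hφ hψ z) z).re := by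
  have hK : ∃ K : ℝ, ∀ᵐ x : ℝ, ∀ i j, |potential (φ x) (ψ x) i j| ≤ K := by
    have h : ∀ p : Fin 4 × Fin 4, ∃ K : ℝ, ∀ᵐ x : ℝ, |potential (φ x) (ψ x) p.1 p.2| ≤ K :=
      fun p => exists_ae_abs_le_of_memLp_top (memLp_potential hφ hψ p.1 p.2)
    choose K hK using h
    refine ⟨∑ p, |K p|, ?_⟩
    filter_upwards [ae_all_iff.2 hK] with x hx i j
    exact ((hx (i, j)).trans (le_abs_self _)).trans
      (Finset.single_le_sum (f := fun p => |K p|) (fun p _ => abs_nonneg _)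
        (Finset.mem_univ (i, j)))
  obtain ⟨K, hK⟩ := hK
  -- Each of the 16 entries contributes at most `K (|zᵢ|² + |zⱼ|²) / 2`, and these add up to `4 K
  -- |z|²`.
  refine ⟨4 * K, fun z => ?_⟩
  rw [re_inner_potentialOp, PiLp.norm_sq_eq_of_L2]
  simp only [norm_sq_eq_integral]
  rw [← integral_finsetSum _ fun i _ => integrable_norm_sq (z i), ← integral_const_mul]
  refine integral_mono_ae ?_ ?_ ?_
  · exact (integrable_finsetSum _ fun i _ => integrable_norm_sq (z i)).const_mul _
  · exact integrable_re_potential_quadratic hφ hψ z z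
  · filter_upwards [hK] with x hx
    have h1 : ∀ i j, -K * ((‖z i x‖ ^ 2 + ‖z j x‖ ^ 2) / 2) ≤
        potential (φ x) (ψ x) i j * (conj (z j x) * z i x).re := by
      intro i j
      have h2 : |(conj (z j x) * z i x).re| ≤ ‖z j x‖ * ‖z i x‖ := by
        refine (Complex.abs_re_le_norm _).trans ?_
        rw [norm_mul, Complex.norm_conj]
      have h3 : |potential (φ x) (ψ x) i j * (conj (z j x) * z i x).re| ≤
          K * (‖z j x‖ * ‖z i x‖) := by
        rw [abs_mul]
        exact mul_le_mul (hx i j) h2 (abs_nonneg _) ((abs_nonneg _).trans (hx i j))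
      have hK0 : 0 ≤ K := (abs_nonneg _).trans (hx i j)
      have h4 := neg_le_of_abs_le h3
      nlinarith [mul_nonneg hK0 (sq_nonneg (‖z j x‖ - ‖z i x‖))]
    refine le_trans (le_of_eq ?_) (Finset.sum_le_sum fun i _ => Finset.sum_le_sum fun j _ => h1 i j)
    simp only [Fin.sum_univ_four]
    ring

theorem re_inner_linOp (ω : ℝ) (z : (linOp ω φ ψ).domain) :
    (inner ℂ (linOp ω φ ψ z) (z : L24)).re =
      ∑ i, (‖weakDeriv ((z : L24) i)‖ ^ 2 + massCoeff ω i * ‖(z : L24) i‖ ^ 2) +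
        (inner ℂ (potentialOp hφ hψ z) (z : L24)).re := by
  have h (f : L2) : (inner ℂ f f).re = ‖f‖ ^ 2 := by
    simpa using inner_self_eq_norm_sq (𝕜 := ℂ) f
  rw [inner_linOp hφ hψ ω z fun i => H2_le_H1 (z.2.1 i), Complex.add_re, Complex.re_sum]
  simp only [Complex.add_re, Complex.re_ofReal_mul, h]

omit hφ hψ in
theorem massCoeff_pos {ω : ℝ} (hω : |ω| < 2 / 3) (i : Fin 4) : 0 < massCoeff ω i := by
  have h : ω ^ 2 < (2 / 3) ^ 2 := sq_lt_sq' (neg_lt_of_abs_lt hω) (lt_of_abs_lt hω)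
  fin_cases i <;> simp [massCoeff] <;> linarith

theorem exists_linOp_lower_bound {ω : ℝ} (hω : |ω| < 2 / 3) :
    ∃ c : ℝ, ∀ z : (linOp ω φ ψ).domain,
      -c * ‖(z : L24)‖ ^ 2 ≤ (inner ℂ (linOp ω φ ψ z) (z : L24)).re := by
  obtain ⟨c, hc⟩ := exists_potential_lower_bound hφ hψ
  refine ⟨c, fun z => ?_⟩
  rw [re_inner_linOp hφ hψ]
  refine (hc z).trans (le_add_of_nonneg_left (Finset.sum_nonneg fun i _ => ?_))
  have := (massCoeff_pos hω i).le
  positivity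

end

/-! ### The variational problem: first and second variation -/

/-- The density of the energy `J`. -/
def densityJ (p q : ℂ) : ℝ :=
  3 * (‖p‖ ^ 4 + ‖q‖ ^ 4 + 4 * ‖p‖ ^ 2 * ‖q‖ ^ 2) + 4 * (conj p ^ 3 * q).re

theorem energyJ_eq (u v : L2) : energyJ u v = ∫ x, densityJ (u x) (v x) := rfl

theorem energyJ_congr {u v : L2} {f g : ℝ → ℂ} (hu : u =ᵐ[volume] f) (hv : v =ᵐ[volume] g) :
    energyJ u v = ∫ x, densityJ (f x) (g x) := by
  rw [energyJ_eq]
  refine integral_congr_ae ?_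
  filter_upwards [hu, hv] with x h1 h2
  rw [h1, h2]

theorem continuous_densityJ : Continuous fun p : ℂ × ℂ => densityJ p.1 p.2 := by
  unfold densityJ
  fun_prop

/-- Bounded `L²` functions thus have integrable density; the constant 20 is not sharp. -/
theorem abs_densityJ_le {K : ℝ} {p q : ℂ} (hp : ‖p‖ ≤ K) (hq : ‖q‖ ≤ K) :
    |densityJ p q| ≤ 20 * K ^ 2 * (‖p‖ ^ 2 + ‖q‖ ^ 2) := by
  have h1 : |(conj p ^ 3 * q).re| ≤ ‖p‖ ^ 3 * ‖q‖ := by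
    refine (Complex.abs_re_le_norm _).trans ?_
    rw [norm_mul, norm_pow, Complex.norm_conj]
  set a := ‖p‖
  set b := ‖q‖
  have ha : 0 ≤ a := norm_nonneg p
  have hb : 0 ≤ b := norm_nonneg q
  have haK : a ^ 2 ≤ K ^ 2 := pow_le_pow_left₀ ha hp 2
  have hbK : b ^ 2 ≤ K ^ 2 := pow_le_pow_left₀ hb hq 2
  have h2 : |densityJ p q| ≤ 3 * (a ^ 4 + b ^ 4 + 4 * a ^ 2 * b ^ 2) + 4 * (a ^ 3 * b) := by
    unfold densityJ
    refine (abs_add_le _ _).trans ?_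
    rw [abs_of_nonneg (a := 3 * (_ : ℝ)) (by positivity), abs_mul, abs_of_pos (by norm_num : (0:ℝ) < 4)]
    linarith
  refine h2.trans ?_
  have h3 : a ^ 3 * b ≤ a ^ 2 * ((a ^ 2 + b ^ 2) / 2) := by
    nlinarith [mul_nonneg (sq_nonneg a) (sq_nonneg (a - b))]
  have h4 := mul_le_mul_of_nonneg_right haK (sq_nonneg a)
  have h5 := mul_le_mul_of_nonneg_right haK (sq_nonneg b)
  have h6 := mul_le_mul_of_nonneg_right hbK (sq_nonneg b)
  nlinarith

theorem exists_ae_norm_le_of_mem_H1 {f : L2} (hf : f ∈ H1) : ∃ K : ℝ, ∀ᵐ x : ℝ, ‖f x‖ ≤ K := by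
  obtain ⟨K, hK⟩ := exists_ae_abs_le_of_memLp_top (memLp_top_of_mem_H1 hf).norm
  exact ⟨K, by simpa using hK⟩

theorem integrable_densityJ {f g : L2} (hf : f ∈ H1) (hg : g ∈ H1) :
    Integrable (fun x => densityJ (f x) (g x)) volume := by
  obtain ⟨K₁, hK₁⟩ := exists_ae_norm_le_of_mem_H1 hf
  obtain ⟨K₂, hK₂⟩ := exists_ae_norm_le_of_mem_H1 hg
  have hb : Integrable (fun x => 20 * (max K₁ K₂) ^ 2 * (‖f x‖ ^ 2 + ‖g x‖ ^ 2)) volume :=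
    ((integrable_norm_sq f).add (integrable_norm_sq g)).const_mul _
  have hm : AEStronglyMeasurable (fun x => densityJ (f x) (g x)) volume :=
    continuous_densityJ.comp_aestronglyMeasurable (f := fun x => (f x, g x))
      ((Lp.aestronglyMeasurable f).prodMk (Lp.aestronglyMeasurable g))
  have hle : ∀ᵐ x : ℝ, ‖densityJ (f x) (g x)‖ ≤
      20 * (max K₁ K₂) ^ 2 * (‖f x‖ ^ 2 + ‖g x‖ ^ 2) := by
    filter_upwards [hK₁, hK₂] with x h1 h2
    exact abs_densityJ_le (h1.trans (le_max_left _ _)) (h2.trans (le_max_right _ _))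
  exact hb.mono' hm hle

theorem energyI_eq (ω : ℝ) (u v : L2) : energyI ω u v =
    ‖weakDeriv u‖ ^ 2 + ‖weakDeriv v‖ ^ 2 + (4 - ω ^ 2) * ‖u‖ ^ 2 + (4 - 9 * ω ^ 2) * ‖v‖ ^ 2 := by
  simp only [norm_sq_eq_integral, energyI]
  have h1 := integrable_norm_sq (weakDeriv u)
  have h2 := integrable_norm_sq (weakDeriv v)
  have h3 := (integrable_norm_sq u).const_mul (4 - ω ^ 2)
  have h4 := (integrable_norm_sq v).const_mul (4 - 9 * ω ^ 2)
  rw [integral_add (by fun_prop) h4, integral_add (by fun_prop) h3, integral_add h1 h2,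
    integral_const_mul, integral_const_mul]

theorem densityJ_smul (s : ℝ) (p q : ℂ) :
    densityJ ((s : ℂ) * p) ((s : ℂ) * q) = s ^ 4 * densityJ p q := by
  unfold densityJ
  have h : conj ((s : ℂ) * p) ^ 3 * ((s : ℂ) * q) = ((s ^ 4 : ℝ) : ℂ) * (conj p ^ 3 * q) := by
    rw [map_mul, Complex.conj_ofReal]; push_cast; ring
  have h2 : |s| ^ 4 = s ^ 4 := by rw [← abs_pow, abs_of_nonneg (by positivity)]
  rw [h, Complex.re_ofReal_mul, norm_mul, norm_mul, Complex.norm_real, Real.norm_eq_abs, mul_pow,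
    mul_pow, mul_pow, mul_pow, sq_abs, h2]
  ring

theorem energyJ_smul (s : ℝ) (u v : L2) :
    energyJ ((s : ℂ) • u) ((s : ℂ) • v) = s ^ 4 * energyJ u v := by
  rw [energyJ_congr (Lp.coeFn_smul (s : ℂ) u) (Lp.coeFn_smul (s : ℂ) v), energyJ_eq,
    ← integral_const_mul]
  exact integral_congr_ae (.of_forall fun x => densityJ_smul s (u x) (v x))

theorem energyI_smul (ω s : ℝ) {u v : L2} (hu : u ∈ H1) (hv : v ∈ H1) :
    energyI ω ((s : ℂ) • u) ((s : ℂ) • v) = s ^ 2 * energyI ω u v := by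
  simp only [energyI_eq, weakDeriv_smul _ hu, weakDeriv_smul _ hv, norm_smul, Complex.norm_real,
    Real.norm_eq_abs, mul_pow, sq_abs]
  ring

theorem mass_pos {ω : ℝ} (hω : |ω| < 2 / 3) : 0 < 4 - ω ^ 2 ∧ 0 < 4 - 9 * ω ^ 2 := by
  have h : ω ^ 2 < (2 / 3) ^ 2 := sq_lt_sq' (neg_lt_of_abs_lt hω) (lt_of_abs_lt hω)
  constructor <;> nlinarith [sq_nonneg ω]

theorem energyI_pos {ω : ℝ} (hω : |ω| < 2 / 3) {u v : L2} (h : u ≠ 0 ∨ v ≠ 0) :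
    0 < energyI ω u v := by
  obtain ⟨h1, h3⟩ := mass_pos hω
  rw [energyI_eq]
  rcases h with h | h
  · have := norm_pos_iff.2 h
    positivity
  · have := norm_pos_iff.2 h
    positivity

/-- Scaling to `I = 1` turns the constrained maximum into a bound on all of `H¹ × H¹`, so that
perturbations need not respect the constraint. -/
theorem energyJ_le {ω : ℝ} (hω : |ω| < 2 / 3) {U V : L2} (hmax : IsMaximizer ω U V)
    {u v : L2} (hu : u ∈ H1) (hv : v ∈ H1) :
    energyJ u v ≤ energyJ U V * energyI ω u v ^ 2 := by
  by_cases h : u ≠ 0 ∨ v ≠ 0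
  · have hI := energyI_pos hω h
    set s : ℝ := (√(energyI ω u v))⁻¹ with hs
    have hs2 : s ^ 2 * energyI ω u v = 1 := by
      rw [hs, inv_pow, Real.sq_sqrt hI.le, inv_mul_cancel₀ hI.ne']
    have h1 := hmax.2.2.2 _ (H1.smul_mem (s : ℂ) hu) _ (H1.smul_mem (s : ℂ) hv)
      (by rw [energyI_smul ω s hu hv, hs2])
    rw [energyJ_smul] at h1
    have h2 := mul_le_mul_of_nonneg_right h1 (sq_nonneg (energyI ω u v))
    refine le_trans (le_of_eq ?_) h2
    linear_combination (-energyJ u v * (1 + s ^ 2 * energyI ω u v)) * hs2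
  · push Not at h
    have h0 := energyJ_smul 0 u v
    have h0' := energyI_smul ω 0 hu hv
    rw [h.1, h.2] at h0 h0' ⊢
    simp only [smul_zero] at h0 h0'
    rw [h0, h0']
    norm_num

/-- Dividing by `t` and letting `t → 0` from each side gives `α = 0`; dividing by `t²` then gives `β
≥ 0`. -/
theorem quartic_nonneg {α β γ δ : ℝ}
    (h : ∀ t : ℝ, 0 ≤ α * t + β * t ^ 2 + γ * t ^ 3 + δ * t ^ 4) : α = 0 ∧ 0 ≤ β := by
  have h0 : ∀ f : ℝ → ℝ, Continuous f → (∀ t, 0 < t → 0 ≤ f t) → 0 ≤ f 0 := by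
    intro f hf h
    refine ge_of_tendsto (x := nhdsWithin (0 : ℝ) (Set.Ioi 0))
      ((hf.tendsto 0).mono_left nhdsWithin_le_nhds) ?_
    filter_upwards [self_mem_nhdsWithin] with t ht
    exact h t ht
  have hα : α = 0 := by
    refine le_antisymm ?_ ?_
    · have := h0 (fun t => -α + β * t - γ * t ^ 2 + δ * t ^ 3) (by fun_prop) fun t ht => by
        have := h (-t)
        refine nonneg_of_mul_nonneg_right (b := -α + β * t - γ * t ^ 2 + δ * t ^ 3) ?_ ht
        linarith
      norm_num at this
      linarith
    · have := h0 (fun t => α + β * t + γ * t ^ 2 + δ * t ^ 3) (by fun_prop) fun t ht => by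
        have := h t
        refine nonneg_of_mul_nonneg_right (b := α + β * t + γ * t ^ 2 + δ * t ^ 3) ?_ ht
        linarith
      norm_num at this
      linarith
  refine ⟨hα, ?_⟩
  have := h0 (fun t => β + γ * t + δ * t ^ 2) (by fun_prop) fun t ht => by
    have := h t
    refine nonneg_of_mul_nonneg_right (b := β + γ * t + δ * t ^ 2) ?_ (pow_pos ht 2)
    rw [hα] at this
    linarith
  norm_num at this
  linarith

/-- A family of integrable functions that is a quartic polynomial in the parameter has integrable
coefficients. -/
theorem integral_quartic {F : ℝ → ℝ → ℝ} {e₀ e₁ e₂ e₃ e₄ : ℝ → ℝ}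
    (hF : ∀ t x, F t x = e₀ x + e₁ x * t + e₂ x * t ^ 2 + e₃ x * t ^ 3 + e₄ x * t ^ 4)
    (hint : ∀ t, Integrable (F t) volume) (t : ℝ) :
    ∫ x, F t x = (∫ x, e₀ x) + (∫ x, e₁ x) * t + (∫ x, e₂ x) * t ^ 2 + (∫ x, e₃ x) * t ^ 3
      + (∫ x, e₄ x) * t ^ 4 := by
  have i0 : Integrable e₀ volume := (hint 0).congr (.of_forall fun x => by simp [hF])
  -- The odd part in `s` is `e₁ s + e₃ s³` and the even part without `e₀` is `e₂ s² + e₄ s⁴`; the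
  -- values at `s = 1, 2` determine all four coefficients.
  have iodd (s : ℝ) : Integrable (fun x => (F s x - F (-s) x) / 2) volume :=
    ((hint s).sub (hint (-s))).div_const 2
  have ieven (s : ℝ) : Integrable (fun x => (F s x + F (-s) x) / 2 - e₀ x) volume :=
    (((hint s).add (hint (-s))).div_const 2).sub i0
  have i3 : Integrable e₃ volume := (((iodd 2).sub ((iodd 1).const_mul 2)).div_const 6).congr
    (.of_forall fun x => by simp only [hF, Pi.sub_apply]; ring)
  have i1 : Integrable e₁ volume := ((iodd 1).sub i3).congr
    (.of_forall fun x => by simp only [hF, Pi.sub_apply]; ring)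
  have i4 : Integrable e₄ volume := (((ieven 2).sub ((ieven 1).const_mul 4)).div_const 12).congr
    (.of_forall fun x => by simp only [hF, Pi.sub_apply]; ring)
  have i2 : Integrable e₂ volume := ((ieven 1).sub i4).congr
    (.of_forall fun x => by simp only [hF, Pi.sub_apply]; ring)
  simp only [hF]
  rw [integral_add (by fun_prop) (by fun_prop), integral_add (by fun_prop) (by fun_prop),
    integral_add (by fun_prop) (by fun_prop), integral_add (by fun_prop) (by fun_prop),
    integral_mul_const, integral_mul_const, integral_mul_const, integral_mul_const]

/-- The first variation of the density at a real point. -/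
def firstVar (a b : ℝ) (h k : ℂ) : ℝ :=
  (12 * a ^ 3 + 24 * a * b ^ 2 + 12 * a ^ 2 * b) * h.re +
    (12 * b ^ 3 + 24 * a ^ 2 * b + 4 * a ^ 3) * k.re

/-- The real vector of real and imaginary parts of a pair. -/
def realVec (h k : ℂ) : Fin 4 → ℝ := ![h.re, h.im, k.re, k.im]

/-- The quadratic form of the matrix potential. -/
def potentialForm (a b : ℝ) (y : Fin 4 → ℝ) : ℝ := ∑ i, ∑ j, potential a b i j * (y j * y i)

/-- The matrix potential is minus half the Hessian of the density at a real point. The cubic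
coefficient stays implicit because only the first two orders are used. -/
theorem exists_densityJ_expansion (a b : ℝ) (h k : ℂ) : ∃ e₃ : ℝ, ∀ t : ℝ,
    densityJ (a + t * h) (b + t * k) = densityJ a b + firstVar a b h k * t
      + (-potentialForm a b (realVec h k)) * t ^ 2 + e₃ * t ^ 3 + densityJ h k * t ^ 4 := by
  have h4 (p : ℂ) : ‖p‖ ^ 4 = (Complex.normSq p) ^ 2 := by
    rw [← Complex.sq_norm]; ring
  obtain ⟨c, c'⟩ := h
  obtain ⟨d, d'⟩ := k
  refine ⟨12 * (a * c * (c ^ 2 + c' ^ 2) + b * d * (d ^ 2 + d' ^ 2))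
    + 24 * (a * c * (d ^ 2 + d' ^ 2) + b * d * (c ^ 2 + c' ^ 2))
    + 4 * (3 * a * ((c ^ 2 - c' ^ 2) * d + 2 * c * c' * d') + b * (c ^ 3 - 3 * c * c' ^ 2)),
    fun t => ?_⟩
  simp only [densityJ, h4, Complex.sq_norm, firstVar, potentialForm, realVec, potential,
    Fin.sum_univ_four, Complex.normSq_apply]
  simp [pow_succ]
  ring

/-- The sesquilinear form polarizing the energy `I`. -/
def formI (ω : ℝ) (U V h k : L2) : ℂ :=
  inner ℂ (weakDeriv U) (weakDeriv h) + inner ℂ (weakDeriv V) (weakDeriv k) +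
    ((4 - ω ^ 2 : ℝ) : ℂ) * inner ℂ U h + ((4 - 9 * ω ^ 2 : ℝ) : ℂ) * inner ℂ V k

theorem energyI_add_smul (ω t : ℝ) {U V h k : L2} (hU : U ∈ H1) (hV : V ∈ H1) (hh : h ∈ H1)
    (hk : k ∈ H1) : energyI ω (U + (t : ℂ) • h) (V + (t : ℂ) • k) =
      energyI ω U V + 2 * t * (formI ω U V h k).re + t ^ 2 * energyI ω h k := by
  have key (x y : L2) : ‖x + (t : ℂ) • y‖ ^ 2 =
      ‖x‖ ^ 2 + 2 * t * (inner ℂ x y).re + t ^ 2 * ‖y‖ ^ 2 := by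
    rw [norm_add_sq (𝕜 := ℂ), inner_smul_right, norm_smul, Complex.norm_real, mul_pow,
      Real.norm_eq_abs, sq_abs, RCLike.re_eq_complex_re, Complex.re_ofReal_mul]
    ring
  simp only [energyI_eq, weakDeriv_add hU (H1.smul_mem _ hh), weakDeriv_add hV (H1.smul_mem _ hk),
    weakDeriv_smul _ hh, weakDeriv_smul _ hk, key, formI, Complex.add_re, Complex.re_ofReal_mul]
  ring

theorem densityJ_ofReal (a b : ℝ) :
    densityJ a b = 3 * (a ^ 4 + b ^ 4 + 4 * a ^ 2 * b ^ 2) + 4 * (a ^ 3 * b) := by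
  have h4 (s : ℝ) : |s| ^ 4 = s ^ 4 := by rw [← abs_pow, abs_of_nonneg (by positivity)]
  simp only [densityJ, Complex.conj_ofReal, Complex.norm_real, Real.norm_eq_abs, h4, sq_abs]
  rw [← Complex.ofReal_pow, ← Complex.ofReal_mul, Complex.ofReal_re]

section Variation

variable {ω : ℝ} (hω : |ω| < 2 / 3) {U V : L2} (hmax : IsMaximizer ω U V) {a b : ℝ → ℝ}
  (ha : U =ᵐ[volume] fun x => (a x : ℂ)) (hb : V =ᵐ[volume] fun x => (b x : ℂ))

include hω hmax ha hb

theorem first_and_second_variation {h k : L2} (hh : h ∈ H1) (hk : k ∈ H1) :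
    ∫ x, firstVar (a x) (b x) (h x) (k x) = 4 * energyJ U V * (formI ω U V h k).re ∧
      ((formI ω U V h k).re = 0 → 0 ≤ 2 * energyJ U V * energyI ω h k +
        ∫ x, potentialForm (a x) (b x) (realVec (h x) (k x))) := by
  have hexp := fun x => exists_densityJ_expansion (a x) (b x) (h x) (k x)
  choose e₃ he₃ using hexp
  have hmem (t : ℝ) : U + (t : ℂ) • h ∈ H1 ∧ V + (t : ℂ) • k ∈ H1 :=
    ⟨H1.add_mem hmax.1 (H1.smul_mem _ hh), H1.add_mem hmax.2.1 (H1.smul_mem _ hk)⟩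
  have hae {f g : L2} {c : ℝ → ℝ} (hf : f =ᵐ[volume] fun x => (c x : ℂ)) (t : ℝ) :
      (f + (t : ℂ) • g : L2) =ᵐ[volume] fun x => c x + t * g x := by
    filter_upwards [hf, Lp.coeFn_add f ((t : ℂ) • g), Lp.coeFn_smul (t : ℂ) g] with x h1 h2 h3
    rw [h2, Pi.add_apply, h3, h1, Pi.smul_apply, smul_eq_mul]
  have hint (t : ℝ) : Integrable (fun x => densityJ (a x + t * h x) (b x + t * k x)) volume := by
    refine (integrable_densityJ (hmem t).1 (hmem t).2).congr ?_
    filter_upwards [hae (g := h) ha t, hae (g := k) hb t] with x h1 h2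
    rw [h1, h2]
  have hJ (t : ℝ) := integral_quartic
    (F := fun t x => densityJ (a x + t * h x) (b x + t * k x)) (fun t x => he₃ x t) hint t
  have hJ0 : ∫ x, densityJ (a x) (b x) = energyJ U V := (energyJ_congr ha hb).symm
  set M := energyJ U V
  set B := (formI ω U V h k).re with hB
  set I₂ := energyI ω h k
  rw [hJ0, integral_neg] at hJ
  -- These are the coefficients of `M (1 + 2 B t + I₂ t²)² - J[U + t h, V + t k]`, whose constant
  -- term cancels.
  obtain ⟨h1, h2⟩ := quartic_nonneg (α := 4 * M * B - ∫ x, firstVar (a x) (b x) (h x) (k x))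
    (β := M * (4 * B ^ 2 + 2 * I₂) + ∫ x, potentialForm (a x) (b x) (realVec (h x) (k x)))
    (γ := 4 * M * B * I₂ - ∫ x, e₃ x) (δ := M * I₂ ^ 2 - ∫ x, densityJ (h x) (k x)) (by
      intro t
      have h3 := energyJ_le hω hmax (hmem t).1 (hmem t).2
      rw [energyJ_congr (hae ha t) (hae hb t), hJ,
        energyI_add_smul ω t hmax.1 hmax.2.1 hh hk, hmax.2.2.1] at h3
      linarith)
  refine ⟨by linarith, fun hB0 => ?_⟩
  rw [hB0] at h2
  linarith

end Variation

/-- Homogeneity of degree 4: the `t²` coefficient of `(1 + t)⁴` is 6. -/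
theorem integral_potentialForm_self {U V : L2} {a b : ℝ → ℝ}
    (ha : U =ᵐ[volume] fun x => (a x : ℂ)) (hb : V =ᵐ[volume] fun x => (b x : ℂ)) :
    ∫ x, potentialForm (a x) (b x) (realVec (a x) (b x)) = -6 * energyJ U V := by
  rw [energyJ_congr ha hb, ← integral_const_mul]
  refine integral_congr_ae (.of_forall fun x => ?_)
  simp only [potentialForm, realVec, potential, densityJ_ofReal, Fin.sum_univ_four]
  simp
  ring

/-- Nonnegativity of `a` and `b` makes the term `a³ b` harmless, so zero energy would force `U = V =
0`, against `I = 1`. -/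
theorem energyJ_pos {ω : ℝ} {U V : L2} (hmax : IsMaximizer ω U V) {a b : ℝ → ℝ}
    (ha : U =ᵐ[volume] fun x => (a x : ℂ)) (hb : V =ᵐ[volume] fun x => (b x : ℂ))
    (ha0 : ∀ x, 0 ≤ a x) (hb0 : ∀ x, 0 ≤ b x) : 0 < energyJ U V := by
  have hpos : ∀ x, 3 * (a x ^ 4 + b x ^ 4) ≤ densityJ (a x) (b x) := by
    intro x
    have := ha0 x
    have := hb0 x
    rw [densityJ_ofReal]
    nlinarith [show 0 ≤ a x ^ 2 * b x ^ 2 by positivity, show 0 ≤ a x ^ 3 * b x by positivity]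
  have hnn : ∀ x, 0 ≤ densityJ (a x) (b x) := fun x => le_trans (by positivity) (hpos x)
  have hint : Integrable (fun x => densityJ (a x) (b x)) volume := by
    refine (integrable_densityJ hmax.1 hmax.2.1).congr ?_
    filter_upwards [ha, hb] with x h1 h2
    rw [h1, h2]
  rw [energyJ_congr ha hb]
  refine (integral_nonneg hnn).lt_of_ne fun h0 => ?_
  have h1 := (integral_eq_zero_iff_of_nonneg hnn hint).1 h0.symm
  have hz : ∀ᵐ x : ℝ, a x = 0 ∧ b x = 0 := by
    filter_upwards [h1] with x hx
    have hx' : densityJ (a x) (b x) = 0 := hx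
    have h2 := hpos x
    rw [hx'] at h2
    have h3 : a x ^ 4 = 0 := le_antisymm (by nlinarith [show 0 ≤ b x ^ 4 by positivity]) (by positivity)
    have h4 : b x ^ 4 = 0 := le_antisymm (by nlinarith [show 0 ≤ a x ^ 4 by positivity]) (by positivity)
    exact ⟨pow_eq_zero_iff (by norm_num) |>.1 h3, pow_eq_zero_iff (by norm_num) |>.1 h4⟩
  have hU : U = 0 := by
    refine Lp.ext ?_
    filter_upwards [ha, hz, Lp.coeFn_zero ℂ 2 (volume : Measure ℝ)] with x h1 h2 h3
    rw [h1, h2.1, h3]; simp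
  have hV : V = 0 := by
    refine Lp.ext ?_
    filter_upwards [hb, hz, Lp.coeFn_zero ℂ 2 (volume : Measure ℝ)] with x h1 h2 h3
    rw [h1, h2.2, h3]; simp
  have hI := hmax.2.2.1
  have h0' := energyI_smul ω 0 hmax.1 hmax.2.1
  rw [hU, hV] at hI h0'
  simp [hI] at h0'

theorem J0_eq {ω : ℝ} {U V : L2} (hmax : IsMaximizer ω U V) : J0 ω = energyJ U V := by
  refine IsGreatest.csSup_eq ⟨⟨U, hmax.1, V, hmax.2.1, hmax.2.2.1, rfl⟩, ?_⟩
  rintro c ⟨u, hu, v, hv, hI, rfl⟩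
  exact hmax.2.2.2 u hu v hv hI

/-! ### Regularity of the maximizers -/

theorem mem_H2_of_weak_equation {f N : L2} {m c : ℝ} (hf : f ∈ H1) (hc : c ≠ 0)
    (h : ∀ g ∈ H1, (inner ℂ N g).re =
      c * (inner ℂ (weakDeriv f) (weakDeriv g) + (m : ℂ) * inner ℂ f g).re) : f ∈ H2 := by
  have h1 : ∀ g ∈ H1, inner ℂ N g =
      c * (inner ℂ (weakDeriv f) (weakDeriv g) + (m : ℂ) * inner ℂ f g) := by
    intro g hg
    -- Testing with `i g` recovers the imaginary part of the identity.
    have h2 := h _ (H1.smul_mem Complex.I hg)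
    rw [weakDeriv_smul _ hg, inner_smul_right, inner_smul_right, inner_smul_right,
      mul_left_comm, ← mul_add, Complex.I_mul_re, Complex.I_mul_re] at h2
    refine Complex.ext ?_ ?_
    · rw [Complex.re_ofReal_mul]; exact h g hg
    · rw [Complex.im_ofReal_mul]; linarith
  refine mem_H2_of_inner (g := (m : ℂ) • f - (c⁻¹ : ℂ) • N) fun θ => ?_
  have h3 := h1 _ (H2_le_H1 (toLp_mem_H2 θ))
  rw [weakDeriv_toLp, inner_weakDeriv hf (H2_le_H1 (toLp_mem_H2 _)), weakDeriv_toLp] at h3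
  rw [inner_sub_left, inner_smul_left, inner_smul_left, h3, map_inv₀, Complex.conj_ofReal,
    Complex.conj_ofReal]
  have hc' : (c : ℂ) ≠ 0 := Complex.ofReal_ne_zero.2 hc
  field_simp
  ring

theorem re_inner_of_real {N : L2} {n : ℝ → ℝ} (hN : N =ᵐ[volume] fun x => (n x : ℂ)) (g : L2) :
    (inner ℂ N g).re = ∫ x, n x * (g x).re := by
  rw [inner_eq_integral]
  have hint : Integrable (fun x => conj (N x) * g x) volume := by
    refine (L2.integrable_inner (𝕜 := ℂ) N g).congr (.of_forall fun x => ?_)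
    simp only [RCLike.inner_apply]
    ring
  refine (integral_re hint).symm.trans (integral_congr_ae ?_)
  filter_upwards [hN] with x hx
  rw [hx, Complex.conj_ofReal, RCLike.re_eq_complex_re, Complex.re_ofReal_mul]

theorem memLp_of_ae_eq_ofReal {f : ℝ → ℂ} {a : ℝ → ℝ} {p : ℝ≥0∞}
    (ha : f =ᵐ[volume] fun x => (a x : ℂ)) (hf : MemLp f p volume) : MemLp a p volume :=
  ((memLp_congr_ae ha).1 hf).re

theorem exists_L2_of_real {n : ℝ → ℝ} (hn : MemLp n 2 volume) :
    ∃ N : L2, N =ᵐ[volume] fun x => (n x : ℂ) :=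
  ⟨hn.ofReal.toLp _, hn.ofReal.coeFn_toLp⟩

/-- The Euler–Lagrange equation is tested in one component at a time; its cubic terms lie in `L²` as
products of one `L²` and two bounded factors. -/
theorem mem_H2_of_isMaximizer {ω : ℝ} (hω : |ω| < 2 / 3) {U V : L2} (hmax : IsMaximizer ω U V)
    {a b : ℝ → ℝ} (ha : U =ᵐ[volume] fun x => (a x : ℂ)) (hb : V =ᵐ[volume] fun x => (b x : ℂ))
    (hJ : 0 < energyJ U V) : U ∈ H2 ∧ V ∈ H2 := by
  have ha2 := memLp_of_ae_eq_ofReal ha (Lp.memLp U)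
  have hb2 := memLp_of_ae_eq_ofReal hb (Lp.memLp V)
  have hai := memLp_of_ae_eq_ofReal ha (memLp_top_of_mem_H1 hmax.1)
  have hbi := memLp_of_ae_eq_ofReal hb (memLp_top_of_mem_H1 hmax.2.1)
  have cubic {f g h : ℝ → ℝ} (hf : MemLp f 2 volume) (hg : MemLp g ∞ volume)
      (hh : MemLp h ∞ volume) : MemLp (fun x => h x * (g x * f x)) 2 volume := by
    have h1 : MemLp (fun x => g x * f x) 2 volume := hf.mul hg
    exact h1.mul hh
  have h1 : MemLp (fun x => 12 * a x ^ 3 + 24 * a x * b x ^ 2 + 12 * a x ^ 2 * b x) 2 volume := by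
    refine (memLp_congr_ae (.of_forall fun x => ?_)).1
      ((((cubic ha2 hai hai).const_mul 12).add ((cubic ha2 hbi hbi).const_mul 24)).add
        ((cubic hb2 hai hai).const_mul 12))
    simp only [Pi.add_apply]
    ring
  have h2 : MemLp (fun x => 12 * b x ^ 3 + 24 * a x ^ 2 * b x + 4 * a x ^ 3) 2 volume := by
    refine (memLp_congr_ae (.of_forall fun x => ?_)).1
      ((((cubic hb2 hbi hbi).const_mul 12).add ((cubic hb2 hai hai).const_mul 24)).add
        ((cubic ha2 hai hai).const_mul 4))
    simp only [Pi.add_apply]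
    ring
  have hc : 4 * energyJ U V ≠ 0 := by positivity
  constructor
  · obtain ⟨N, hN⟩ := exists_L2_of_real h1
    refine mem_H2_of_weak_equation (N := N) (m := 4 - ω ^ 2) hmax.1 hc fun g hg => ?_
    have h3 := (first_and_second_variation hω hmax ha hb hg H1.zero_mem).1
    rw [formI, weakDeriv_zero, inner_zero_right, inner_zero_right, mul_zero, add_zero,
      add_zero] at h3
    rw [← h3, re_inner_of_real hN]
    refine integral_congr_ae (.of_forall fun x => ?_)
    simp [firstVar]
  · obtain ⟨N, hN⟩ := exists_L2_of_real h2
    refine mem_H2_of_weak_equation (N := N) (m := 4 - 9 * ω ^ 2) hmax.2.1 hc fun g hg => ?_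
    have h3 := (first_and_second_variation hω hmax ha hb H1.zero_mem hg).1
    rw [formI, weakDeriv_zero, inner_zero_right, inner_zero_right, mul_zero, zero_add,
      add_zero] at h3
    rw [← h3, re_inner_of_real hN]
    refine integral_congr_ae (.of_forall fun x => ?_)
    simp [firstVar]

/-! ### Real parts -/

/-- The real part of an `L²` function. -/
def reL (f : L2) : L2 := (1 / 2 : ℂ) • (f + star f)

theorem coeFn_reL (f : L2) : reL f =ᵐ[volume] fun x => ((f x).re : ℂ) := by
  filter_upwards [Lp.coeFn_smul (1 / 2 : ℂ) (f + star f), Lp.coeFn_add f (star f),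
    Lp.coeFn_star f] with x h1 h2 h3
  rw [reL, h1, Pi.smul_apply, h2, Pi.add_apply, h3, Complex.re_eq_add_conj, smul_eq_mul]
  simp only [Pi.star_apply, RCLike.star_def]
  ring

theorem reL_mem_H1 {f : L2} (hf : f ∈ H1) : reL f ∈ H1 :=
  H1.smul_mem _ (H1.add_mem hf (star_mem_H1 hf))

theorem weakDeriv_reL {f : L2} (hf : f ∈ H1) : weakDeriv (reL f) = reL (weakDeriv f) := by
  rw [reL, weakDeriv_smul _ (H1.add_mem hf (star_mem_H1 hf)), weakDeriv_add hf (star_mem_H1 hf),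
    weakDeriv_star hf, reL]

theorem weakDeriv_ae_real {f : L2} (hf : f ∈ H1) {a : ℝ → ℝ}
    (ha : f =ᵐ[volume] fun x => (a x : ℂ)) :
    weakDeriv f =ᵐ[volume] fun x => ((weakDeriv f x).re : ℂ) := by
  have h1 : reL f = f := by
    refine Lp.ext ?_
    filter_upwards [coeFn_reL f, ha] with x h1 h2
    rw [h1, h2, Complex.ofReal_re]
  have h2 := coeFn_reL (weakDeriv f)
  rwa [← weakDeriv_reL hf, h1] at h2

/-- The complex function with real part `Re f` and imaginary part `Re g`. -/
def mixRe (f g : L2) : L2 := reL f + Complex.I • reL g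

theorem coeFn_mixRe (f g : L2) : mixRe f g =ᵐ[volume] fun x => ⟨(f x).re, (g x).re⟩ := by
  filter_upwards [Lp.coeFn_add (reL f) (Complex.I • reL g), Lp.coeFn_smul Complex.I (reL g),
    coeFn_reL f, coeFn_reL g] with x h1 h2 h3 h4
  rw [mixRe, h1, Pi.add_apply, h2, Pi.smul_apply, h3, h4]
  apply Complex.ext <;> simp

theorem mixRe_mem_H1 {f g : L2} (hf : f ∈ H1) (hg : g ∈ H1) : mixRe f g ∈ H1 :=
  H1.add_mem (reL_mem_H1 hf) (H1.smul_mem _ (reL_mem_H1 hg))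

theorem weakDeriv_mixRe {f g : L2} (hf : f ∈ H1) (hg : g ∈ H1) :
    weakDeriv (mixRe f g) = mixRe (weakDeriv f) (weakDeriv g) := by
  rw [mixRe, weakDeriv_add (reL_mem_H1 hf) (H1.smul_mem _ (reL_mem_H1 hg)),
    weakDeriv_smul _ (reL_mem_H1 hg), weakDeriv_reL hf, weakDeriv_reL hg, mixRe]

/-- Multiplication by `-i` replaces real parts by imaginary parts, so the two mixtures together
carry the whole norm. -/
theorem norm_sq_mixRe_add (f g : L2) :
    ‖mixRe f g‖ ^ 2 + ‖mixRe (-Complex.I • f) (-Complex.I • g)‖ ^ 2 = ‖f‖ ^ 2 + ‖g‖ ^ 2 := by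
  simp only [norm_sq_eq_integral]
  rw [← integral_add (integrable_norm_sq _) (integrable_norm_sq _),
    ← integral_add (integrable_norm_sq _) (integrable_norm_sq _)]
  refine integral_congr_ae ?_
  filter_upwards [coeFn_mixRe f g, coeFn_mixRe (-Complex.I • f) (-Complex.I • g),
    Lp.coeFn_smul (-Complex.I) f, Lp.coeFn_smul (-Complex.I) g] with x h1 h2 h3 h4
  rw [h1, h2, h3, h4]
  simp only [Complex.sq_norm, Complex.normSq_apply, Pi.smul_apply, smul_eq_mul]
  simp
  ring

theorem re_inner_mixRe {N : L2} {n : ℝ → ℝ} (hN : N =ᵐ[volume] fun x => (n x : ℂ)) (f g : L2) :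
    (inner ℂ N (mixRe f g)).re = (inner ℂ N f).re := by
  rw [re_inner_of_real hN, re_inner_of_real hN]
  refine integral_congr_ae ?_
  filter_upwards [coeFn_mixRe f g] with x hx
  rw [hx]

/-- The componentwise real part. -/
def reVec (z : L24) : L24 := WithLp.toLp 2 fun i => reL (z i)

/-- `U`, `V` and their derivatives are real, so the constraint sees only the real parts of a
perturbation, that is components 0 and 2 of `L²(ℝ)⁴`. -/
theorem re_formI_mixRe {ω : ℝ} {U V : L2} (hU : U ∈ H1) (hV : V ∈ H1) {a b : ℝ → ℝ}
    (ha : U =ᵐ[volume] fun x => (a x : ℂ)) (hb : V =ᵐ[volume] fun x => (b x : ℂ))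
    {f f' g g' : L2} (hf : f ∈ H1) (hf' : f' ∈ H1) (hg : g ∈ H1) (hg' : g' ∈ H1) :
    (formI ω U V (mixRe f f') (mixRe g g')).re = (formI ω U V f g).re := by
  simp only [formI, Complex.add_re, Complex.re_ofReal_mul, weakDeriv_mixRe hf hf',
    weakDeriv_mixRe hg hg', re_inner_mixRe ha, re_inner_mixRe hb,
    re_inner_mixRe (weakDeriv_ae_real hU ha), re_inner_mixRe (weakDeriv_ae_real hV hb)]

/-! ### The form of the linearized operator at a maximizer -/

theorem potential_smul (s a b : ℝ) (i j : Fin 4) :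
    potential (s * a) (s * b) i j = s ^ 2 * potential a b i j := by
  obtain ⟨M₁, M₂, M₃, h⟩ := exists_potential_eq
  rw [h, h]
  ring

section Waves

variable {ω s : ℝ} {U V : L2} {a b φ ψ : ℝ → ℝ}

theorem exists_linOp_neg (hω : |ω| < 2 / 3) (hmax : IsMaximizer ω U V)
    (ha : U =ᵐ[volume] fun x => (a x : ℂ)) (hb : V =ᵐ[volume] fun x => (b x : ℂ))
    (hs : s ^ 2 * (2 * energyJ U V) = 1) (hφs : ∀ x, φ x = s * a x) (hψs : ∀ x, ψ x = s * b x)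
    (hJ : 0 < energyJ U V) (hφ : MemLp φ ∞ volume) (hψ : MemLp ψ ∞ volume) :
    ∃ z : (linOp ω φ ψ).domain, (inner ℂ (linOp ω φ ψ z) (z : L24)).re < 0 := by
  obtain ⟨hU, hV⟩ := mem_H2_of_isMaximizer hω hmax ha hb hJ
  set z : L24 := WithLp.toLp 2 ![(s : ℂ) • U, 0, (s : ℂ) • V, 0] with hz
  have z0 : z 0 = (s : ℂ) • U := rfl
  have z1 : z 1 = 0 := rfl
  have z2 : z 2 = (s : ℂ) • V := rfl
  have z3 : z 3 = 0 := rfl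
  have hzd : z ∈ (linOp ω φ ψ).domain := by
    rw [mem_linOp_domain_iff hφ hψ]
    intro i
    fin_cases i
    · exact H2.smul_mem _ hU
    · exact H2.zero_mem
    · exact H2.smul_mem _ hV
    · exact H2.zero_mem
  have hpot : (inner ℂ (potentialOp hφ hψ z) z).re = s ^ 4 * (-6 * energyJ U V) := by
    rw [re_inner_potentialOp, ← integral_potentialForm_self ha hb, ← integral_const_mul]
    refine integral_congr_ae ?_
    filter_upwards [ha, hb, Lp.coeFn_smul (s : ℂ) U, Lp.coeFn_smul (s : ℂ) V,
      Lp.coeFn_zero ℂ 2 (volume : Measure ℝ)] with x h1 h2 h3 h4 h5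
    have hy : ∀ i, z i x = ((s * realVec (a x) (b x) i : ℝ) : ℂ) := by
      intro i
      fin_cases i
      · change ((s : ℂ) • U : L2) x = _
        rw [h3, Pi.smul_apply, h1]
        simp [realVec]
      · change (0 : L2) x = _
        rw [h5]
        simp [realVec]
      · change ((s : ℂ) • V : L2) x = _
        rw [h4, Pi.smul_apply, h2]
        simp [realVec]
      · change (0 : L2) x = _
        rw [h5]
        simp [realVec]
    rw [potentialForm, Finset.mul_sum]
    refine Finset.sum_congr rfl fun i _ => ?_
    rw [Finset.mul_sum]
    refine Finset.sum_congr rfl fun j _ => ?_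
    rw [hy, hy, hφs, hψs, potential_smul, Complex.conj_ofReal, ← Complex.ofReal_mul,
      Complex.ofReal_re]
    ring
  refine ⟨⟨z, hzd⟩, ?_⟩
  rw [re_inner_linOp hφ hψ]
  change ∑ i, (‖weakDeriv (z i)‖ ^ 2 + massCoeff ω i * ‖z i‖ ^ 2) +
    (inner ℂ (potentialOp hφ hψ z) z).re < 0
  have hI := energyI_smul ω s hmax.1 hmax.2.1
  rw [hmax.2.2.1, energyI_eq] at hI
  rw [hpot, Fin.sum_univ_four, z0, z1, z2, z3, weakDeriv_zero, norm_zero]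
  simp only [massCoeff, Matrix.cons_val]
  have hs0 : 0 < s ^ 2 := by
    rcases (sq_nonneg s).eq_or_lt with h | h
    · rw [← h] at hs; simp at hs
    · exact h
  -- The energy part of the form is `s² I[U, V] = s²`, so the total is `-2 s²`.
  have h6 : s ^ 4 * (-6 * energyJ U V) = -3 * s ^ 2 := by
    linear_combination (-3 * s ^ 2) * hs
  rw [h6]
  nlinarith

/-- This is the second variation in the direction `(Re z₀ + i Re z₁, Re z₂ + i Re z₃)`, multiplied
by `s²`. -/
theorem re_form_nonneg (hω : |ω| < 2 / 3) (hmax : IsMaximizer ω U V)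
    (ha : U =ᵐ[volume] fun x => (a x : ℂ)) (hb : V =ᵐ[volume] fun x => (b x : ℂ))
    (hs : s ^ 2 * (2 * energyJ U V) = 1) (hφs : ∀ x, φ x = s * a x) (hψs : ∀ x, ψ x = s * b x)
    {z : L24} (hz : ∀ i, z i ∈ H1) (hl : formI ω U V (z 0) (z 2) = 0) :
    0 ≤ energyI ω (mixRe (z 0) (z 1)) (mixRe (z 2) (z 3)) +
      ∫ x, potentialForm (φ x) (ψ x) fun i => (z i x).re := by
  have h1 := (first_and_second_variation hω hmax ha hb (mixRe_mem_H1 (hz 0) (hz 1))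
    (mixRe_mem_H1 (hz 2) (hz 3))).2 (by
      rw [re_formI_mixRe hmax.1 hmax.2.1 ha hb (hz 0) (hz 1) (hz 2) (hz 3), hl, Complex.zero_re])
  have h2 : ∫ x, potentialForm (φ x) (ψ x) (fun i => (z i x).re) = s ^ 2 *
      ∫ x, potentialForm (a x) (b x)
        (realVec (mixRe (z 0) (z 1) x) (mixRe (z 2) (z 3) x)) := by
    rw [← integral_const_mul]
    refine integral_congr_ae ?_
    filter_upwards [coeFn_mixRe (z 0) (z 1), coeFn_mixRe (z 2) (z 3)] with x h3 h4
    have hy : realVec (mixRe (z 0) (z 1) x) (mixRe (z 2) (z 3) x) = fun i => (z i x).re := by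
      rw [h3, h4]
      funext i
      fin_cases i <;> rfl
    rw [hy, potentialForm, potentialForm, Finset.mul_sum]
    refine Finset.sum_congr rfl fun i _ => ?_
    rw [Finset.mul_sum]
    refine Finset.sum_congr rfl fun j _ => ?_
    rw [hφs, hψs, potential_smul]
    ring
  rw [h2]
  have h5 := mul_nonneg (sq_nonneg s) h1
  refine h5.trans (le_of_eq ?_)
  linear_combination (energyI ω (mixRe (z 0) (z 1)) (mixRe (z 2) (z 3))) * hs

theorem linOp_nonneg_of_formI_eq_zero (hω : |ω| < 2 / 3) (hmax : IsMaximizer ω U V)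
    (ha : U =ᵐ[volume] fun x => (a x : ℂ)) (hb : V =ᵐ[volume] fun x => (b x : ℂ))
    (hs : s ^ 2 * (2 * energyJ U V) = 1) (hφs : ∀ x, φ x = s * a x) (hψs : ∀ x, ψ x = s * b x)
    (hφ : MemLp φ ∞ volume) (hψ : MemLp ψ ∞ volume) (z : (linOp ω φ ψ).domain)
    (hl : formI ω U V ((z : L24) 0) ((z : L24) 2) = 0) :
    0 ≤ (inner ℂ (linOp ω φ ψ z) (z : L24)).re := by
  have hz : ∀ i, (z : L24) i ∈ H1 := fun i => H2_le_H1 (z.2.1 i)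
  rw [re_inner_linOp hφ hψ]
  set y : L24 := (z : L24) with hy
  -- The real part of `w` is the imaginary part of `y`. The complex condition `hl` gives the
  -- constraint for both, and the form at `y` is the sum of the two real forms.
  set w : L24 := -Complex.I • y with hw
  have hwi : ∀ i, w i = -Complex.I • y i := fun i => rfl
  have hwm : ∀ i, w i ∈ H1 := fun i => H1.smul_mem _ (hz i)
  have hlw : formI ω U V (w 0) (w 2) = 0 := by
    have : formI ω U V (w 0) (w 2) = -Complex.I * formI ω U V (y 0) (y 2) := by
      simp only [formI, hwi, weakDeriv_smul _ (hz _), inner_smul_right]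
      ring
    rw [this, hl, mul_zero]
  have h1 := re_form_nonneg hω hmax ha hb hs hφs hψs hz hl
  have h2 := re_form_nonneg hω hmax ha hb hs hφs hψs hwm hlw
  have hint : ∀ v : L24, Integrable (fun x => potentialForm (φ x) (ψ x) fun i => (v i x).re)
      volume := by
    intro v
    refine (integrable_re_potential_quadratic hφ hψ (reVec v) (reVec v)).congr ?_
    filter_upwards [ae_all_iff.2 fun i => coeFn_reL (v i)] with x hx
    refine Finset.sum_congr rfl fun i _ => Finset.sum_congr rfl fun j _ => ?_
    have h3 : ∀ i, reVec v i x = ((v i x).re : ℂ) := hx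
    rw [h3, h3, Complex.conj_ofReal, ← Complex.ofReal_mul, Complex.ofReal_re]
  have hpot : (inner ℂ (potentialOp hφ hψ y) y).re =
      (∫ x, potentialForm (φ x) (ψ x) fun i => (y i x).re) +
        ∫ x, potentialForm (φ x) (ψ x) fun i => (w i x).re := by
    rw [re_inner_potentialOp, ← integral_add (hint y) (hint w)]
    refine integral_congr_ae ?_
    filter_upwards [ae_all_iff.2 fun i => Lp.coeFn_smul (-Complex.I) (y i)] with x hx
    have h3 : ∀ i, w i x = -Complex.I * y i x := hx
    simp only [potentialForm, ← Finset.sum_add_distrib]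
    refine Finset.sum_congr rfl fun i _ => Finset.sum_congr rfl fun j _ => ?_
    rw [h3, h3]
    simp
    ring
  have h01 := norm_sq_mixRe_add (y 0) (y 1)
  have h23 := norm_sq_mixRe_add (y 2) (y 3)
  have d01 := norm_sq_mixRe_add (weakDeriv (y 0)) (weakDeriv (y 1))
  have d23 := norm_sq_mixRe_add (weakDeriv (y 2)) (weakDeriv (y 3))
  rw [energyI_eq, weakDeriv_mixRe (hz 0) (hz 1), weakDeriv_mixRe (hz 2) (hz 3)] at h1
  rw [energyI_eq, weakDeriv_mixRe (hwm 0) (hwm 1), weakDeriv_mixRe (hwm 2) (hwm 3)] at h2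
  simp only [hwi, weakDeriv_smul _ (hz _)] at h2
  simp only [hwi] at hpot
  rw [hpot, Fin.sum_univ_four]
  simp only [massCoeff, Matrix.cons_val]
  have e1 := congrArg (fun r : ℝ => (4 - ω ^ 2) * r) h01
  have e2 := congrArg (fun r : ℝ => (4 - 9 * ω ^ 2) * r) h23
  simp only [mul_add] at e1 e2
  linarith

end Waves

end Oscillon

end


theorem mainTheorem3 (ω : ℝ) (hω : |ω| < 2 / 3) (φ ψ : ℝ → ℝ)
    (hwave : Oscillon.IsOscillonWave ω φ ψ) :
    ((∀ z, z ∈ (Oscillon.linOp ω φ ψ).domain ↔ ∀ i, z i ∈ Oscillon.H2) ∧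
      IsSelfAdjoint (Oscillon.linOp ω φ ψ)) ∧
    (∃ σ : ℝ, σ < 0 ∧
      Module.finrank ℂ (Oscillon.eigenspace (Oscillon.linOp ω φ ψ) (σ : ℂ)) = 1 ∧
      ∀ τ : ℝ, τ < 0 →
        Oscillon.eigenspace (Oscillon.linOp ω φ ψ) (τ : ℂ) ≠ ⊥ → τ = σ) ∧
    Oscillon.morseIndex (Oscillon.linOp ω φ ψ) = 1 := by
  open Oscillon in
  obtain ⟨a, b, hBa, hBb, ⟨hU, hV, hmax⟩, hφ', hψ'⟩ := hwave
  have ha := hU.coeFn_toLp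
  have hb := hV.coeFn_toLp
  have hJ : 0 < energyJ (hU.toLp _) (hV.toLp _) := energyJ_pos hmax ha hb hBa.nonneg hBb.nonneg
  rw [J0_eq hmax] at hφ' hψ'
  set s : ℝ := (√(2 * energyJ (hU.toLp _) (hV.toLp _)))⁻¹ with hsdef
  have hs : s ^ 2 * (2 * energyJ (hU.toLp _) (hV.toLp _)) = 1 := by
    have h2J : 0 < 2 * energyJ (hU.toLp _) (hV.toLp _) := by linarith
    rw [hsdef, inv_pow, Real.sq_sqrt h2J.le, inv_mul_cancel₀ h2J.ne']
  have hφs : ∀ x, φ x = s * a x := fun x => by rw [hφ', div_eq_mul_inv, mul_comm]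
  have hψs : ∀ x, ψ x = s * b x := fun x => by rw [hψ', div_eq_mul_inv, mul_comm]
  have hφ : MemLp φ ∞ volume := by
    rw [funext hφs]
    exact (memLp_of_ae_eq_ofReal ha (memLp_top_of_mem_H1 hmax.1)).const_mul s
  have hψ : MemLp ψ ∞ volume := by
    rw [funext hψs]
    exact (memLp_of_ae_eq_ofReal hb (memLp_top_of_mem_H1 hmax.2.1)).const_mul s
  have hsa := isSelfAdjoint_linOp hφ hψ ω
  obtain ⟨c, hc⟩ := exists_linOp_lower_bound hφ hψ hω
  obtain ⟨z₀, hz₀⟩ := exists_linOp_neg hω hmax ha hb hs hφs hψs hJ hφ hψ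
  -- The complex-linear extension of the first variation of `I`; its kernel is the hyperplane on
  -- which the form is nonnegative.
  let l : (linOp ω φ ψ).domain →ₗ[ℂ] ℂ :=
    { toFun := fun z => formI ω (hU.toLp _) (hV.toLp _) ((z : L24) 0) ((z : L24) 2)
      map_add' := fun z w => by
        have h1 : ∀ i, ((z + w : (linOp ω φ ψ).domain) : L24) i = (z : L24) i + (w : L24) i :=
          fun i => rfl
        simp only [formI, h1, weakDeriv_add (H2_le_H1 (z.2.1 _)) (H2_le_H1 (w.2.1 _)),
          inner_add_right]
        ring
      map_smul' := fun r z => by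
        have h1 : ∀ i, ((r • z : (linOp ω φ ψ).domain) : L24) i = r • (z : L24) i :=
          fun i => rfl
        simp only [formI, h1, weakDeriv_smul _ (H2_le_H1 (z.2.1 _)), inner_smul_right,
          RingHom.id_apply, smul_eq_mul]
        ring }
  have hl : ∀ z, l z = 0 → 0 ≤ (inner ℂ (linOp ω φ ψ z) (z : L24)).re := fun z hz =>
    linOp_nonneg_of_formI_eq_zero hω hmax ha hb hs hφs hψs hφ hψ z hz
  obtain ⟨σ, hσ, e, he, hAe⟩ := exists_neg_eigenvector hsa hc l hl hz₀
  refine ⟨⟨mem_linOp_domain_iff hφ hψ ω, hsa⟩,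
    ⟨σ, hσ, finrank_eigenspace_eq_one l hl hσ he hAe, fun τ hτ hne => ?_⟩,
    morseIndex_eq_one l hl hz₀⟩
  obtain ⟨f, hf, hf0⟩ := Submodule.exists_mem_ne_zero_of_ne_bot hne
  obtain ⟨hfd, hAf⟩ := mem_eigenspace_iff.1 hf
  exact neg_eigenvalue_unique hsa l hl hσ hτ he hAe
    (fun h => hf0 (congrArg (fun z : (linOp ω φ ψ).domain => (z : L24)) h)) hAf
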